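/- A \emph{tangency} $(\pi,T)$ is a cartesian (Grothendieck) fibration $\pi\colon E\to B$ equipped with a functor $T\colon B\to E$ such that $\pi T=\mathrm{id}_B$. The 2-category $\mathcal{T}\mathsf{an}$ has tangencies as objects. A 1-cell $(\pi_1,T_1)\to(\pi_2,T_2)$ consists of functors $f\colon B_1\to B_2$ and $\overline f\colon E_1\to E_2$ with $\pi_2\overline f=f\pi_1$ and $\overline f$ preserving cartesian arrows, together with a natural transformation $\phi\colon \overline f T_1\Rightarrow T_2 f$ with $\pi_2\phi=\mathrm{id}_f$. A 2-cell $(f,\overline f,\phi)\Rightarrow(g,\overline g,\psi)$ is a pair of natural transformations $\alpha\colon f\Rightarrow g$, $\overline\alpha\colon\overline f\Rightarrow\overline g$ with $\pi_2\overline\alpha=\alpha\pi_1$ and $T_2\alpha\circ\phi=\psi\circ\overline\alpha T_1$. This 2-category has finite (strict) products, formed componentwise. A \emph{symmetric monoidal tangency} is a symmetric pseudomonoid in $\mathcal{T}\mathsf{an}$. Lemma (Symmetric monoidal tangency). Let $(\pi\colon E\to B,\;T\colon B\to E)$ be a tangency. Symmetric pseudomonoid structures on $(\pi,T)$ in $\mathcal{T}\mathsf{an}$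 are in bijection with the following data: (i) symmetric monoidal structures on $E$ and $B$ making $\pi$ a symmetric monoidal fibration, that is, $\pi$ is a strict symmetric monoidal functor and the tensor product of $E$ preserves cartesian arrows; and (ii) a lax symmetric monoidal structure on $T$ for which $T$ is a section of $\pi$ as a lax monoidal functor, that is, the laxator $TS_1\otimes TS_2\to T(S_1\otimes S_2)$ and the lax unit $1_E\to T(1_B)$ lie over identities of $B$. The bijection preserves the underlying data: the tensor functors, units, associators, unitors and symmetries of $E$ and $B$ are the two components of the multiplication, unit and structural 2-cells of the pseudomonoid, and the laxator and lax unit of $T$ are the comparison transformations $\phi$ of its multiplication and its unit. -/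

import Mathlib

open CategoryTheory Bicategory

universe w v u

namespace Tangencies

/-! ### Cartesian 2-categories and symmetric pseudomonoids -/

/-- A cartesian 2-category: a strict 2-category with chosen finite products in the strict,
`Cat`-enriched sense. Postcomposition with the projections is an isomorphism of categories
`K(Z, A × B) ≅ K(Z, A) × K(Z, B)`, and `K(Z, 1)` is the terminal category. -/
class CartesianTwoCategory (K : Type u) [Bicategory.{w, v} K] [Bicategory.Strict K] where
  /-- the terminal object -/
  terminal : K
  /-- the 1-cell to the terminal object -/
  toTerminal (Z : K) : Z ⟶ terminal
  toTerminal_unique {Z : K} (f g : Z ⟶ terminal) : f = g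
  /-- the 2-cell between 1-cells to the terminal object -/
  toTerminal₂ {Z : K} (f g : Z ⟶ terminal) : f ⟶ g
  toTerminal₂_unique {Z : K} {f g : Z ⟶ terminal} (η θ : f ⟶ g) : η = θ
  /-- the product of two objects -/
  prod : K → K → K
  /-- first projection -/
  fst {A B : K} : prod A B ⟶ A
  /-- second projection -/
  snd {A B : K} : prod A B ⟶ B
  /-- pairing of 1-cells -/
  lift {Z A B : K} (f : Z ⟶ A) (g : Z ⟶ B) : Z ⟶ prod A B
  lift_fst {Z A B : K} (f : Z ⟶ A) (g : Z ⟶ B) : lift f g ≫ fst = f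
  lift_snd {Z A B : K} (f : Z ⟶ A) (g : Z ⟶ B) : lift f g ≫ snd = g
  hom_ext {Z A B : K} {h k : Z ⟶ prod A B} :
    h ≫ fst = k ≫ fst → h ≫ snd = k ≫ snd → h = k
  /-- pairing of 2-cells -/
  lift₂ {Z A B : K} {h k : Z ⟶ prod A B} (η : h ≫ fst ⟶ k ≫ fst) (θ : h ≫ snd ⟶ k ≫ snd) :
    h ⟶ k
  lift₂_fst {Z A B : K} {h k : Z ⟶ prod A B} (η : h ≫ fst ⟶ k ≫ fst)
    (θ : h ≫ snd ⟶ k ≫ snd) : lift₂ η θ ▷ fst = η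
  lift₂_snd {Z A B : K} {h k : Z ⟶ prod A B} (η : h ≫ fst ⟶ k ≫ fst)
    (θ : h ≫ snd ⟶ k ≫ snd) : lift₂ η θ ▷ snd = θ
  hom₂_ext {Z A B : K} {h k : Z ⟶ prod A B} {η θ : h ⟶ k} :
    η ▷ fst = θ ▷ fst → η ▷ snd = θ ▷ snd → η = θ

section Pseudomonoid

open CartesianTwoCategory

variable {K : Type u} [Bicategory.{w, v} K] [Bicategory.Strict K] [CartesianTwoCategory K]

theorem comp_lift {Y Z A B : K} (h : Y ⟶ Z) (f : Z ⟶ A) (g : Z ⟶ B) :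
    h ≫ lift f g = lift (h ≫ f) (h ≫ g) := by
  apply hom_ext
  · rw [Strict.assoc, lift_fst, lift_fst]
  · rw [Strict.assoc, lift_snd, lift_snd]

/-- The 2-cell `(f, g) ⟶ (f', g')` between 1-cells into a product given by two 2-cells. -/
def pairHom {Z A B : K} {f f' : Z ⟶ A} {g g' : Z ⟶ B} (η : f ⟶ f') (θ : g ⟶ g') :
    lift f g ⟶ lift f' g' :=
  lift₂ (eqToHom (lift_fst f g) ≫ η ≫ eqToHom (lift_fst f' g').symm)
    (eqToHom (lift_snd f g) ≫ θ ≫ eqToHom (lift_snd f' g').symm)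

/-- The product `f ⊗ g` of two generalised elements `f g : Z ⟶ X` under `m : X × X ⟶ X`. -/
def mulAt {Z X : K} (m : prod X X ⟶ X) (f g : Z ⟶ X) : Z ⟶ X :=
  lift f g ≫ m

/-- The product of two 2-cells between generalised elements. -/
def mulMap {Z X : K} (m : prod X X ⟶ X) {f f' g g' : Z ⟶ X} (η : f ⟶ f') (θ : g ⟶ g') :
    mulAt m f g ⟶ mulAt m f' g' :=
  pairHom η θ ▷ m

/-- The unit, as a generalised element `Z ⟶ X`. -/
def oneAt {X : K} (i : terminal ⟶ X) (Z : K) : Z ⟶ X :=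
  toTerminal Z ≫ i

theorem comp_mulAt {Y Z X : K} (m : prod X X ⟶ X) (h : Y ⟶ Z) (f g : Z ⟶ X) :
    h ≫ mulAt m f g = mulAt m (h ≫ f) (h ≫ g) := by
  rw [mulAt, mulAt, ← Strict.assoc, comp_lift]

theorem comp_oneAt {Y Z X : K} (i : terminal ⟶ X) (h : Y ⟶ Z) :
    h ≫ oneAt i Z = oneAt i Y := by
  rw [oneAt, oneAt, ← Strict.assoc]
  congr 1
  exact toTerminal_unique _ _

/-- The data of a symmetric pseudomonoid on an object `X` of a cartesian 2-category. The
structural 2-cells are given at the universal generalised elements, i.e. at the projections of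
`X × X × X`, `X` and `X × X`. -/
structure SymmetricPseudomonoidData (X : K) where
  /-- multiplication `X × X ⟶ X` -/
  mul : prod X X ⟶ X
  /-- unit `1 ⟶ X` -/
  one : terminal ⟶ X
  /-- the associator `(x ⊗ y) ⊗ z ≅ x ⊗ (y ⊗ z)` on `(X × X) × X` -/
  associator :
    (mulAt mul (mulAt mul (fst ≫ fst) (fst ≫ snd)) snd : prod (prod X X) X ⟶ X) ≅
      mulAt mul (fst ≫ fst) (mulAt mul (fst ≫ snd) snd)
  /-- the left unitor `1 ⊗ x ≅ x` on `X` -/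
  leftUnitor : mulAt mul (oneAt one X) (𝟙 X) ≅ 𝟙 X
  /-- the right unitor `x ⊗ 1 ≅ x` on `X` -/
  rightUnitor : mulAt mul (𝟙 X) (oneAt one X) ≅ 𝟙 X
  /-- the symmetry `x ⊗ y ≅ y ⊗ x` on `X × X` -/
  braiding : (mulAt mul fst snd : prod X X ⟶ X) ≅ mulAt mul snd fst

namespace SymmetricPseudomonoidData

variable {X : K} (M : SymmetricPseudomonoidData X) {Z : K}

theorem assocAt_src (f g h : Z ⟶ X) :
    lift (lift f g) h ≫ mulAt M.mul (mulAt M.mul (fst ≫ fst) (fst ≫ snd)) snd =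
      mulAt M.mul (mulAt M.mul f g) h := by
  simp only [comp_mulAt, ← Strict.assoc, lift_fst, lift_snd]

theorem assocAt_tgt (f g h : Z ⟶ X) :
    lift (lift f g) h ≫ mulAt M.mul (fst ≫ fst) (mulAt M.mul (fst ≫ snd) snd) =
      mulAt M.mul f (mulAt M.mul g h) := by
  simp only [comp_mulAt, ← Strict.assoc, lift_fst, lift_snd]

/-- The associator at generalised elements `f g h : Z ⟶ X`, obtained by whiskering. -/
def assocAt (f g h : Z ⟶ X) :
    mulAt M.mul (mulAt M.mul f g) h ⟶ mulAt M.mul f (mulAt M.mul g h) :=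
  eqToHom (M.assocAt_src f g h).symm ≫ lift (lift f g) h ◁ M.associator.hom ≫
    eqToHom (M.assocAt_tgt f g h)

/-- The left unitor at a generalised element. -/
def leftUnitorAt (f : Z ⟶ X) : mulAt M.mul (oneAt M.one Z) f ⟶ f :=
  eqToHom (by rw [comp_mulAt, comp_oneAt, Strict.comp_id]) ≫ f ◁ M.leftUnitor.hom ≫
    eqToHom (Strict.comp_id f)

/-- The right unitor at a generalised element. -/
def rightUnitorAt (f : Z ⟶ X) : mulAt M.mul f (oneAt M.one Z) ⟶ f :=
  eqToHom (by rw [comp_mulAt, comp_oneAt, Strict.comp_id]) ≫ f ◁ M.rightUnitor.hom ≫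
    eqToHom (Strict.comp_id f)

/-- The symmetry at generalised elements. -/
def braidingAt (f g : Z ⟶ X) : mulAt M.mul f g ⟶ mulAt M.mul g f :=
  eqToHom (by rw [comp_mulAt, lift_fst, lift_snd]) ≫ lift f g ◁ M.braiding.hom ≫
    eqToHom (by rw [comp_mulAt, lift_fst, lift_snd])

end SymmetricPseudomonoidData

/-- A symmetric pseudomonoid structure (symmetric monoidal structure) on an object `X` of a
cartesian 2-category. The axioms are equations between 2-cells `Xⁿ ⟶ X`; they are written
at arbitrary generalised elements `Z ⟶ X`, of which the projections of `Xⁿ` are the universal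
case. -/
structure SymmetricPseudomonoid (X : K) extends SymmetricPseudomonoidData X where
  pentagon {Z : K} (a b c d : Z ⟶ X) :
    mulMap mul (toSymmetricPseudomonoidData.assocAt a b c) (𝟙 d) ≫
        toSymmetricPseudomonoidData.assocAt a (mulAt mul b c) d ≫
          mulMap mul (𝟙 a) (toSymmetricPseudomonoidData.assocAt b c d) =
      toSymmetricPseudomonoidData.assocAt (mulAt mul a b) c d ≫
        toSymmetricPseudomonoidData.assocAt a b (mulAt mul c d)
  triangle {Z : K} (a b : Z ⟶ X) :
    toSymmetricPseudomonoidData.assocAt a (oneAt one Z) b ≫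
        mulMap mul (𝟙 a) (toSymmetricPseudomonoidData.leftUnitorAt b) =
      mulMap mul (toSymmetricPseudomonoidData.rightUnitorAt a) (𝟙 b)
  hexagon {Z : K} (a b c : Z ⟶ X) :
    toSymmetricPseudomonoidData.assocAt a b c ≫
        toSymmetricPseudomonoidData.braidingAt a (mulAt mul b c) ≫
          toSymmetricPseudomonoidData.assocAt b c a =
      mulMap mul (toSymmetricPseudomonoidData.braidingAt a b) (𝟙 c) ≫
        toSymmetricPseudomonoidData.assocAt b a c ≫
          mulMap mul (𝟙 b) (toSymmetricPseudomonoidData.braidingAt a c)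
  symmetry {Z : K} (a b : Z ⟶ X) :
    toSymmetricPseudomonoidData.braidingAt a b ≫
      toSymmetricPseudomonoidData.braidingAt b a = 𝟙 (mulAt mul a b)

end Pseudomonoid

end Tangencies

/-! ### The 2-category of tangencies -/

/-- A tangency: a cartesian (Grothendieck) fibration `π : E ⥤ B` with a strict section `T`. -/
structure Tangency where
  /-- the base category `B` -/
  Base : Type u
  /-- the total category `E` -/
  Total : Type u
  [catBase : Category.{v} Base]
  [catTotal : Category.{v} Total]
  /-- the fibration `π : E ⥤ B` -/
  proj : Total ⥤ Base
  isFibered : proj.IsFibered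
  /-- the section `T : B ⥤ E` -/
  sec : Base ⥤ Total
  sec_proj : sec ⋙ proj = 𝟭 Base

namespace Tangency

attribute [instance] catBase catTotal

theorem proj_sec (X : Tangency.{v, u}) (b : X.Base) : X.proj.obj (X.sec.obj b) = b :=
  Functor.congr_obj X.sec_proj b

/-- A morphism of tangencies: a cartesian functor `(f, f̄)` (a strictly commuting square such
that `f̄` preserves cartesian arrows) with a natural transformation `φ : T₁ ⋙ f̄ ⟶ f ⋙ T₂`
lying over the identity of `f`. -/
structure Hom (X Y : Tangency.{v, u}) where
  /-- the functor `f` between the bases -/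
  base : X.Base ⥤ Y.Base
  /-- the functor `f̄` between the total categories -/
  total : X.Total ⥤ Y.Total
  comm : total ⋙ Y.proj = X.proj ⋙ base
  map_cartesian {e e' : X.Total} (g : e ⟶ e') :
    X.proj.IsStronglyCartesian (X.proj.map g) g →
      Y.proj.IsStronglyCartesian (Y.proj.map (total.map g)) (total.map g)
  /-- the colax comparison `φ` of the sections -/
  comparison : X.sec ⋙ total ⟶ base ⋙ Y.sec
  comparison_over (b : X.Base) : Y.proj.IsHomLift (𝟙 (base.obj b)) (comparison.app b)

/-- A 2-cell of tangencies `F ⟶ G`: natural transformations `α : f ⟶ g` and `ᾱ : f̄ ⟶ ḡ`,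
with `ᾱ` lying over `α`, compatible with the comparisons of the sections. -/
structure Hom₂ {X Y : Tangency.{v, u}} (F G : Hom X Y) where
  /-- the transformation `α` on the bases -/
  base : F.base ⟶ G.base
  /-- the transformation `ᾱ` on the total categories -/
  total : F.total ⟶ G.total
  lies_over (e : X.Total) : Y.proj.IsHomLift (base.app (X.proj.obj e)) (total.app e)
  comparison (b : X.Base) :
    F.comparison.app b ≫ Y.sec.map (base.app b) =
      total.app (X.sec.obj b) ≫ G.comparison.app b

@[ext]
theorem Hom₂.ext' {X Y : Tangency.{v, u}} {F G : Hom X Y} {η θ : Hom₂ F G}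
    (h₁ : ∀ b, η.base.app b = θ.base.app b) (h₂ : ∀ e, η.total.app e = θ.total.app e) :
    η = θ := by
  obtain ⟨a, b, _, _⟩ := η
  obtain ⟨a', b', _, _⟩ := θ
  obtain rfl : a = a' := NatTrans.ext (funext h₁)
  obtain rfl : b = b' := NatTrans.ext (funext h₂)
  rfl

theorem Hom.ext' {X Y : Tangency.{v, u}} {F G : Hom X Y} (h₁ : F.base = G.base)
    (h₂ : F.total = G.total) (h₃ : ∀ b, HEq (F.comparison.app b) (G.comparison.app b)) :
    F = G := by
  obtain ⟨f, f', _, _, φ, _⟩ := F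
  obtain ⟨g, g', _, _, ψ, _⟩ := G
  obtain rfl : f = g := h₁
  obtain rfl : f' = g' := h₂
  obtain rfl : φ = ψ := NatTrans.ext (funext fun b => eq_of_heq (h₃ b))
  rfl

theorem Hom.comm_obj {X Y : Tangency.{v, u}} (F : Hom X Y) (e : X.Total) :
    Y.proj.obj (F.total.obj e) = F.base.obj (X.proj.obj e) :=
  Functor.congr_obj F.comm e

/-- The total functor of a morphism sends arrows over `k` to arrows over the image of `k`. -/
theorem Hom.map_over {X Y : Tangency.{v, u}} (F : Hom X Y) {b b' : X.Base} (k : b ⟶ b')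
    {e e' : X.Total} (g : e ⟶ e') (h : X.proj.IsHomLift k g) :
    Y.proj.IsHomLift (F.base.map k) (F.total.map g) := by
  obtain ⟨⟩ := h
  apply IsHomLift.of_fac' _ _ _ (F.comm_obj _) (F.comm_obj _)
  exact Functor.congr_hom F.comm g

/-- Vertical identity 2-cell. -/
def Hom₂.id {X Y : Tangency.{v, u}} (F : Hom X Y) : Hom₂ F F where
  base := 𝟙 F.base
  total := 𝟙 F.total
  lies_over e := IsHomLift.id (F.comm_obj e)
  comparison b := by simp

/-- Vertical composite of 2-cells. -/
def Hom₂.comp {X Y : Tangency.{v, u}} {F G H : Hom X Y} (η : Hom₂ F G) (θ : Hom₂ G H) :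
    Hom₂ F H where
  base := η.base ≫ θ.base
  total := η.total ≫ θ.total
  lies_over e := by
    have := η.lies_over e
    have := θ.lies_over e
    rw [NatTrans.comp_app, NatTrans.comp_app]
    infer_instance
  comparison b := by
    simp only [NatTrans.comp_app, CategoryTheory.Functor.map_comp, Category.assoc]
    rw [← θ.comparison, ← Category.assoc, η.comparison, Category.assoc]

/-- The identity morphism of a tangency. -/
def Hom.id (X : Tangency.{v, u}) : Hom X X where
  base := 𝟭 _
  total := 𝟭 _
  comm := rfl
  map_cartesian _ h := h
  comparison := 𝟙 X.sec
  comparison_over b := IsHomLift.id (X.proj_sec b)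

/-- Composition of morphisms of tangencies: the comparison of `F` followed by `G` is
`ḡ (φ) ≫ ψ`. -/
def Hom.comp {X Y Z : Tangency.{v, u}} (F : Hom X Y) (G : Hom Y Z) : Hom X Z where
  base := F.base ⋙ G.base
  total := F.total ⋙ G.total
  comm := by
    rw [Functor.assoc, G.comm, ← Functor.assoc, F.comm, Functor.assoc]
  map_cartesian _ h := G.map_cartesian _ (F.map_cartesian _ h)
  comparison :=
    { app := fun b => G.total.map (F.comparison.app b) ≫ G.comparison.app (F.base.obj b)
      naturality := fun b b' k => by
        have h₁ := F.comparison.naturality k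
        have h₂ := G.comparison.naturality (F.base.map k)
        dsimp at h₁ h₂ ⊢
        rw [← Category.assoc, ← CategoryTheory.Functor.map_comp, h₁, CategoryTheory.Functor.map_comp, Category.assoc, h₂,
          Category.assoc] }
  comparison_over b := by
    have h₁ := G.map_over _ _ (F.comparison_over b)
    have h₂ := G.comparison_over (F.base.obj b)
    rw [CategoryTheory.Functor.map_id] at h₁
    exact @IsHomLift.comp_of_lift_id _ _ _ _ _ _ _ _ _ _ _ h₁ h₂

instance homCategory (X Y : Tangency.{v, u}) : Category (Hom X Y) where
  Hom := Hom₂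
  id := Hom₂.id
  comp := Hom₂.comp
  id_comp η := by apply Hom₂.ext' <;> intro <;> exact Category.id_comp _
  comp_id η := by apply Hom₂.ext' <;> intro <;> exact Category.comp_id _
  assoc η θ κ := by apply Hom₂.ext' <;> intro <;> exact Category.assoc _ _ _

/-- Left whiskering. -/
def whiskerLeft₂ {X Y Z : Tangency.{v, u}} (F : Hom X Y) {G H : Hom Y Z} (η : Hom₂ G H) :
    Hom₂ (F.comp G) (F.comp H) where
  base := Functor.whiskerLeft F.base η.base
  total := Functor.whiskerLeft F.total η.total
  lies_over e := by
    have h := η.lies_over (F.total.obj e)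
    rw [F.comm_obj] at h
    exact h
  comparison b := by
    have h := η.total.naturality (F.comparison.app b)
    have h' := η.comparison (F.base.obj b)
    dsimp [Hom.comp] at h ⊢
    rw [Category.assoc, h', ← Category.assoc, h, Category.assoc]

/-- Right whiskering. -/
def whiskerRight₂ {X Y Z : Tangency.{v, u}} {F G : Hom X Y} (η : Hom₂ F G) (H : Hom Y Z) :
    Hom₂ (F.comp H) (G.comp H) where
  base := Functor.whiskerRight η.base H.base
  total := Functor.whiskerRight η.total H.total
  lies_over e := H.map_over _ _ (η.lies_over e)
  comparison b := by
    have h := H.comparison.naturality (η.base.app b)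
    have h' := η.comparison b
    dsimp [Hom.comp] at h ⊢
    rw [Category.assoc, ← h, ← Category.assoc, ← CategoryTheory.Functor.map_comp, h', CategoryTheory.Functor.map_comp,
      Category.assoc]

theorem Hom.comp_id' {X Y : Tangency.{v, u}} (F : Hom X Y) : F.comp (Hom.id Y) = F :=
  Hom.ext' rfl rfl fun _ => heq_of_eq (Category.comp_id _)

theorem Hom.id_comp' {X Y : Tangency.{v, u}} (F : Hom X Y) : (Hom.id X).comp F = F := by
  refine Hom.ext' rfl rfl fun b => heq_of_eq ?_
  change F.total.map (𝟙 _) ≫ F.comparison.app b = _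
  rw [CategoryTheory.Functor.map_id]
  exact Category.id_comp _

theorem Hom.assoc' {W X Y Z : Tangency.{v, u}} (F : Hom W X) (G : Hom X Y) (H : Hom Y Z) :
    (F.comp G).comp H = F.comp (G.comp H) := by
  refine Hom.ext' rfl rfl fun b => heq_of_eq ?_
  simp [Hom.comp]

theorem eqToHom_base_app {X Y : Tangency.{v, u}} {F G : Hom X Y} (h : F = G) (b : X.Base) :
    (Hom₂.base (eqToHom h)).app b = eqToHom (by rw [h]) := by
  subst h; rfl

theorem eqToHom_total_app {X Y : Tangency.{v, u}} {F G : Hom X Y} (h : F = G) (e : X.Total) :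
    (Hom₂.total (eqToHom h)).app e = eqToHom (by rw [h]) := by
  subst h; rfl

theorem eq_eqToHom_comp {X Y : Tangency.{v, u}} {F G F' G' : Hom X Y} (hF : F = F')
    (hG : G' = G) (η : F ⟶ G) (θ : F' ⟶ G')
    (h₁ : ∀ b, HEq ((Hom₂.base η).app b) ((Hom₂.base θ).app b))
    (h₂ : ∀ e, HEq ((Hom₂.total η).app e) ((Hom₂.total θ).app e)) :
    η = eqToHom hF ≫ θ ≫ eqToHom hG := by
  subst hF hG
  simp only [eqToHom_refl, Category.comp_id, Category.id_comp]
  exact Hom₂.ext' (fun b => eq_of_heq (h₁ b)) fun e => eq_of_heq (h₂ e)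

theorem whiskerLeft₂_eqToHom {X Y Z : Tangency.{v, u}} (F : Hom X Y) {G H : Hom Y Z}
    (h : G = H) : whiskerLeft₂ F (eqToHom h) = eqToHom (congrArg F.comp h) := by
  subst h; rfl

theorem whiskerRight₂_eqToHom {X Y Z : Tangency.{v, u}} {F G : Hom X Y} (h : F = G)
    (H : Hom Y Z) :
    whiskerRight₂ (eqToHom h) H = eqToHom (congrArg (fun K => Hom.comp K H) h) := by
  subst h
  exact Hom₂.ext' (fun _ => CategoryTheory.Functor.map_id _ _)
    fun _ => CategoryTheory.Functor.map_id _ _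

/-- The 2-category of tangencies. -/
instance bicategory : Bicategory.{max u v, max u v} Tangency.{v, u} where
  Hom := Hom
  id := Hom.id
  comp := Hom.comp
  homCategory := homCategory
  whiskerLeft F _ _ η := whiskerLeft₂ F η
  whiskerRight η H := whiskerRight₂ η H
  associator F G H := eqToIso (Hom.assoc' F G H)
  leftUnitor F := eqToIso (Hom.id_comp' F)
  rightUnitor F := eqToIso (Hom.comp_id' F)
  whiskerLeft_id _ _ := by apply Hom₂.ext' <;> intro <;> rfl
  whiskerLeft_comp _ _ _ _ _ _ := by apply Hom₂.ext' <;> intro <;> rfl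
  id_whiskerLeft η := eq_eqToHom_comp (Hom.id_comp' _) (Hom.id_comp' _).symm _ _ (fun _ => HEq.rfl) fun _ => HEq.rfl
  comp_whiskerLeft _ _ _ _ _ := eq_eqToHom_comp (Hom.assoc' _ _ _) (Hom.assoc' _ _ _).symm _ _
    (fun _ => HEq.rfl) fun _ => HEq.rfl
  id_whiskerRight _ _ := by
    apply Hom₂.ext' <;> intro <;> exact CategoryTheory.Functor.map_id _ _
  comp_whiskerRight _ _ _ := by
    apply Hom₂.ext' <;> intro <;> exact CategoryTheory.Functor.map_comp _ _ _
  whiskerRight_id _ := eq_eqToHom_comp (Hom.comp_id' _) (Hom.comp_id' _).symm _ _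
    (fun _ => HEq.rfl) fun _ => HEq.rfl
  whiskerRight_comp _ _ _ := eq_eqToHom_comp (Hom.assoc' _ _ _).symm (Hom.assoc' _ _ _) _ _
    (fun _ => HEq.rfl) fun _ => HEq.rfl
  whisker_assoc _ _ _ _ _ := eq_eqToHom_comp (Hom.assoc' _ _ _) (Hom.assoc' _ _ _).symm _ _
    (fun _ => HEq.rfl) fun _ => HEq.rfl
  whisker_exchange η θ := by
    apply Hom₂.ext' <;> intro
    · exact ((Hom₂.base θ).naturality _).symm
    · exact ((Hom₂.total θ).naturality _).symm
  pentagon _ _ _ _ := by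
    simp [whiskerLeft₂_eqToHom, whiskerRight₂_eqToHom]
  triangle _ _ := by
    simp [whiskerLeft₂_eqToHom, whiskerRight₂_eqToHom]

instance strict : Bicategory.Strict Tangency.{v, u} where
  id_comp F := Hom.id_comp' F
  comp_id F := Hom.comp_id' F
  assoc F G H := Hom.assoc' F G H
  leftUnitor_eqToIso _ := rfl
  rightUnitor_eqToIso _ := rfl
  associator_eqToIso _ _ _ := rfl


/-! Finite products of tangencies. -/

section Products

variable {E B E' B' : Type*} [Category* E] [Category* B] [Category* E'] [Category* B']

theorem prod_isHomLift_iff {p : E ⥤ B} {p' : E' ⥤ B'} {x y : B × B'} {a b : E × E'}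
    (f : x ⟶ y) (g : a ⟶ b) :
    (p.prod p').IsHomLift f g ↔ p.IsHomLift f.1 g.1 ∧ p'.IsHomLift f.2 g.2 := by
  constructor
  · rintro ⟨⟩
    exact ⟨.map _, .map _⟩
  · rintro ⟨h, h'⟩
    have e₁ : (p.prod p').obj a = x :=
      Prod.ext (IsHomLift.domain_eq p f.1 g.1) (IsHomLift.domain_eq p' f.2 g.2)
    have e₂ : (p.prod p').obj b = y :=
      Prod.ext (IsHomLift.codomain_eq p f.1 g.1) (IsHomLift.codomain_eq p' f.2 g.2)
    subst e₁ e₂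
    have e : f = (p.prod p').map g :=
      Prod.ext (IsHomLift.eq_of_isHomLift p f.1 g.1) (IsHomLift.eq_of_isHomLift p' f.2 g.2)
    rw [e]
    exact .map g

theorem prod_isStronglyCartesian {p : E ⥤ B} {p' : E' ⥤ B'} {x y : B × B'} {a b : E × E'}
    {f : x ⟶ y} {g : a ⟶ b} (h : p.IsStronglyCartesian f.1 g.1)
    (h' : p'.IsStronglyCartesian f.2 g.2) : (p.prod p').IsStronglyCartesian f g where
  toIsHomLift := (prod_isHomLift_iff f g).2 ⟨h.toIsHomLift, h'.toIsHomLift⟩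
  universal_property' {c} k m hm := by
    obtain ⟨hm₁, hm₂⟩ := (prod_isHomLift_iff _ _).1 hm
    obtain ⟨n, ⟨hn, hn'⟩, hu⟩ := h.universal_property' k.1 m.1
    obtain ⟨n', ⟨hn₂, hn₂'⟩, hu'⟩ := h'.universal_property' k.2 m.2
    refine ⟨(n, n'), ⟨(prod_isHomLift_iff _ _).2 ⟨hn, hn₂⟩, Prod.ext hn' hn₂'⟩, ?_⟩
    rintro l ⟨hl, hl'⟩
    obtain ⟨hl₁, hl₂⟩ := (prod_isHomLift_iff _ _).1 hl
    exact Prod.ext (hu _ ⟨hl₁, congrArg (·.1) hl'⟩) (hu' _ ⟨hl₂, congrArg (·.2) hl'⟩)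

theorem fst_isStronglyCartesian {p : E ⥤ B} {p' : E' ⥤ B'} {a b : E × E'} {g : a ⟶ b}
    (h : (p.prod p').IsStronglyCartesian ((p.prod p').map g) g) :
    p.IsStronglyCartesian (p.map g.1) g.1 where
  universal_property' {c} k m hm := by
    have hm' : (p.prod p').IsHomLift
        (((k, 𝟙 (p'.obj a.2)) : (p.prod p').obj (c, a.2) ⟶ (p.prod p').obj a) ≫
          (p.prod p').map g) ((m, g.2) : (c, a.2) ⟶ b) := by
      refine (prod_isHomLift_iff _ _).2 ⟨hm, ?_⟩
      change p'.IsHomLift (𝟙 _ ≫ p'.map g.2) g.2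
      rw [Category.id_comp]
      exact .map _
    obtain ⟨n, ⟨hn, hn'⟩, hu⟩ :=
      h.universal_property' ((k, 𝟙 (p'.obj a.2)) : (p.prod p').obj (c, a.2) ⟶ (p.prod p').obj a)
        ((m, g.2) : (c, a.2) ⟶ b)
    refine ⟨n.1, ⟨((prod_isHomLift_iff _ _).1 hn).1, congrArg (·.1) hn'⟩, ?_⟩
    rintro l ⟨hl, hl'⟩
    have := hu ((l, 𝟙 a.2) : (c, a.2) ⟶ a) ⟨(prod_isHomLift_iff _ _).2
      ⟨hl, IsHomLift.id rfl⟩, Prod.ext hl' (Category.id_comp _)⟩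
    exact congrArg (·.1) this

theorem snd_isStronglyCartesian {p : E ⥤ B} {p' : E' ⥤ B'} {a b : E × E'} {g : a ⟶ b}
    (h : (p.prod p').IsStronglyCartesian ((p.prod p').map g) g) :
    p'.IsStronglyCartesian (p'.map g.2) g.2 where
  universal_property' {c} k m hm := by
    have hm' : (p.prod p').IsHomLift
        (((𝟙 (p.obj a.1), k) : (p.prod p').obj (a.1, c) ⟶ (p.prod p').obj a) ≫
          (p.prod p').map g) ((g.1, m) : (a.1, c) ⟶ b) := by
      refine (prod_isHomLift_iff _ _).2 ⟨?_, hm⟩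
      change p.IsHomLift (𝟙 _ ≫ p.map g.1) g.1
      rw [Category.id_comp]
      exact .map _
    obtain ⟨n, ⟨hn, hn'⟩, hu⟩ :=
      h.universal_property' ((𝟙 (p.obj a.1), k) : (p.prod p').obj (a.1, c) ⟶ (p.prod p').obj a)
        ((g.1, m) : (a.1, c) ⟶ b)
    refine ⟨n.2, ⟨((prod_isHomLift_iff _ _).1 hn).2, congrArg (·.2) hn'⟩, ?_⟩
    rintro l ⟨hl, hl'⟩
    have := hu ((𝟙 a.1, l) : (a.1, c) ⟶ a) ⟨(prod_isHomLift_iff _ _).2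
      ⟨IsHomLift.id rfl, hl⟩, Prod.ext (Category.id_comp _) hl'⟩
    exact congrArg (·.2) this

theorem prod_isFibered {p : E ⥤ B} {p' : E' ⥤ B'} (hp : p.IsFibered) (hp' : p'.IsFibered) :
    (p.prod p').IsFibered := by
  apply Functor.IsFibered.of_exists_isStronglyCartesian
  intro a R f
  obtain ⟨c, φ, hφ⟩ := Functor.IsPreFibered.exists_isCartesian' (p := p) f.1
  obtain ⟨c', φ', hφ'⟩ := Functor.IsPreFibered.exists_isCartesian' (p := p') f.2
  exact ⟨(c, c'), (φ, φ'), prod_isStronglyCartesian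
    (inferInstanceAs (p.IsStronglyCartesian f.1 φ))
    (inferInstanceAs (p'.IsStronglyCartesian f.2 φ'))⟩

end Products

/-- The product of two tangencies. -/
abbrev prod (X Y : Tangency.{v, u}) : Tangency.{v, u} where
  Base := X.Base × Y.Base
  Total := X.Total × Y.Total
  proj := X.proj.prod Y.proj
  isFibered := prod_isFibered X.isFibered Y.isFibered
  sec := X.sec.prod Y.sec
  sec_proj := by
    change (X.sec ⋙ X.proj).prod (Y.sec ⋙ Y.proj) = _
    rw [X.sec_proj, Y.sec_proj]
    rfl

/-- The category with one object and one morphism. -/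
structure Point : Type u where

instance : Category.{v} Point.{u} where
  Hom _ _ := PUnit
  id _ := PUnit.unit
  comp _ _ := PUnit.unit

theorem Point.functor_ext {C : Type*} [Category* C] (F G : C ⥤ Point.{u}) : F = G :=
  CategoryTheory.Functor.ext (fun _ => rfl) fun _ _ _ => rfl

/-- The terminal tangency: the identity functor of the terminal category. -/
abbrev terminal : Tangency.{v, u} where
  Base := Point
  Total := Point
  proj := 𝟭 _
  isFibered := by
    apply Functor.IsFibered.of_exists_isStronglyCartesian
    intro a R f
    exact ⟨R, f, { universal_property' := fun k m _ => ⟨k, ⟨.map (p := 𝟭 _) k, rfl⟩, fun _ _ => rfl⟩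
                   toIsHomLift := .map (p := 𝟭 _) f }⟩
  sec := 𝟭 _
  sec_proj := rfl

/-- The unique morphism to the terminal tangency. -/
def toTerminal (X : Tangency.{v, u}) : Hom X terminal where
  base := { obj := fun _ => ⟨⟩, map := fun _ => PUnit.unit }
  total := { obj := fun _ => ⟨⟩, map := fun _ => PUnit.unit }
  comm := rfl
  map_cartesian _ _ :=
    { universal_property' := fun k m _ =>
        ⟨k, ⟨.map (p := 𝟭 Point) k, rfl⟩, fun _ _ => rfl⟩
      toIsHomLift := .map (p := 𝟭 Point) _ }
  comparison := { app := fun _ => PUnit.unit }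
  comparison_over _ := .map (p := 𝟭 Point) PUnit.unit

/-- First projection. -/
def fst (X Y : Tangency.{v, u}) : Hom (X.prod Y) X where
  base := CategoryTheory.Prod.fst _ _
  total := CategoryTheory.Prod.fst _ _
  comm := rfl
  map_cartesian _ h := fst_isStronglyCartesian h
  comparison := 𝟙 (CategoryTheory.Prod.fst _ _ ⋙ X.sec)
  comparison_over b := IsHomLift.id (X.proj_sec b.1)

/-- Second projection. -/
def snd (X Y : Tangency.{v, u}) : Hom (X.prod Y) Y where
  base := CategoryTheory.Prod.snd _ _
  total := CategoryTheory.Prod.snd _ _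
  comm := rfl
  map_cartesian _ h := snd_isStronglyCartesian h
  comparison := 𝟙 (CategoryTheory.Prod.snd _ _ ⋙ Y.sec)
  comparison_over b := IsHomLift.id (Y.proj_sec b.2)

/-- Pairing of morphisms of tangencies. -/
def lift {Z X Y : Tangency.{v, u}} (F : Hom Z X) (G : Hom Z Y) : Hom Z (X.prod Y) where
  base := F.base.prod' G.base
  total := F.total.prod' G.total
  comm := by
    change (F.total ⋙ X.proj).prod' (G.total ⋙ Y.proj) = _
    rw [F.comm, G.comm]
    rfl
  map_cartesian _ h := prod_isStronglyCartesian (F.map_cartesian _ h) (G.map_cartesian _ h)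
  comparison :=
    { app := fun b => (F.comparison.app b, G.comparison.app b)
      naturality := fun _ _ k =>
        Prod.ext (F.comparison.naturality k) (G.comparison.naturality k) }
  comparison_over b :=
    (prod_isHomLift_iff _ _).2 ⟨F.comparison_over b, G.comparison_over b⟩

/-- Pairing of 2-cells. -/
def lift₂ {Z X Y : Tangency.{v, u}} {F G : Hom Z (X.prod Y)}
    (η : Hom₂ (F.comp (fst X Y)) (G.comp (fst X Y)))
    (θ : Hom₂ (F.comp (snd X Y)) (G.comp (snd X Y))) : Hom₂ F G where
  base :=
    { app := fun b => (η.base.app b, θ.base.app b)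
      naturality := fun _ _ k => Prod.ext (η.base.naturality k) (θ.base.naturality k) }
  total :=
    { app := fun b => (η.total.app b, θ.total.app b)
      naturality := fun _ _ k => Prod.ext (η.total.naturality k) (θ.total.naturality k) }
  lies_over e := (prod_isHomLift_iff _ _).2 ⟨η.lies_over e, θ.lies_over e⟩
  comparison b := by
    have h := η.comparison b
    have h' := θ.comparison b
    have e (K : Hom Z (X.prod Y)) : (K.comp (fst X Y)).comparison.app b =
        (K.comparison.app b).1 := Category.comp_id _
    have e' (K : Hom Z (X.prod Y)) : (K.comp (snd X Y)).comparison.app b =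
        (K.comparison.app b).2 := Category.comp_id _
    rw [e, e] at h
    rw [e', e'] at h'
    exact Prod.ext h h'

theorem lift_eta {Z X Y : Tangency.{v, u}} (F : Hom Z (X.prod Y)) :
    lift (F.comp (fst X Y)) (F.comp (snd X Y)) = F :=
  Hom.ext' rfl rfl fun _ => heq_of_eq (Prod.ext (Category.comp_id _) (Category.comp_id _))

instance cartesian : Tangencies.CartesianTwoCategory Tangency.{v, u} where
  terminal := terminal
  toTerminal := toTerminal
  toTerminal_unique _ _ :=
    Hom.ext' (Point.functor_ext _ _) (Point.functor_ext _ _) fun _ => HEq.rfl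
  toTerminal₂ {Z} F G :=
    { base := { app := fun _ => PUnit.unit }
      total := { app := fun _ => PUnit.unit }
      lies_over := fun _ => .map (p := 𝟭 Point) PUnit.unit
      comparison := fun _ => rfl }
  toTerminal₂_unique _ _ := Hom₂.ext' (fun _ => rfl) fun _ => rfl
  prod := prod
  fst := fst _ _
  snd := snd _ _
  lift F G := lift F G
  lift_fst F G := Hom.ext' rfl rfl fun _ => heq_of_eq (Category.comp_id _)
  lift_snd F G := Hom.ext' rfl rfl fun _ => heq_of_eq (Category.comp_id _)
  hom_ext {Z X Y F G} h h' := by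
    rw [← lift_eta F, ← lift_eta G]
    exact congrArg₂ lift h h'
  lift₂ η θ := lift₂ η θ
  lift₂_fst _ _ := Hom₂.ext' (fun _ => rfl) fun _ => rfl
  lift₂_snd _ _ := Hom₂.ext' (fun _ => rfl) fun _ => rfl
  hom₂_ext h h' := Hom₂.ext'
    (fun b => Prod.ext (congrArg (fun κ => (Hom₂.base κ).app b) h)
      (congrArg (fun κ => (Hom₂.base κ).app b) h'))
    (fun b => Prod.ext (congrArg (fun κ => (Hom₂.total κ).app b) h)
      (congrArg (fun κ => (Hom₂.total κ).app b) h'))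

end Tangency

/-! ### Symmetric monoidal fibrations and lax monoidal sections -/

namespace Tangencies

open MonoidalCategory

section

variable {E B : Type u} [Category.{v} E] [Category.{v} B]
  [MonoidalCategory E] [SymmetricCategory E] [MonoidalCategory B] [SymmetricCategory B]

/-- A functor `π : E ⥤ B` between symmetric monoidal categories is a symmetric monoidal
fibration: it is a fibration, it is a strict symmetric monoidal functor (a braided monoidal
functor whose structure morphisms are identities), and the tensor product of `E` preserves
cartesian arrows. -/
structure SymmetricMonoidalFibration (π : E ⥤ B) where
  isFibered : π.IsFibered
  braided : π.Braided
  ε_strict : ∃ h : 𝟙_ B = π.obj (𝟙_ E), Functor.LaxMonoidal.ε π = eqToHom h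
  μ_strict (x y : E) : ∃ h : π.obj x ⊗ π.obj y = π.obj (x ⊗ y),
    Functor.LaxMonoidal.μ π x y = eqToHom h
  tensor_cartesian {x y x' y' : E} (f : x ⟶ y) (f' : x' ⟶ y') :
    π.IsStronglyCartesian (π.map f) f → π.IsStronglyCartesian (π.map f') f' →
      π.IsStronglyCartesian (π.map (f ⊗ₘ f')) (f ⊗ₘ f')

/-- A lax symmetric monoidal section `T` of a strict symmetric monoidal functor `π`: a section
`T`, with a lax symmetric monoidal structure for which `T ⋙ π` is the identity as a lax
monoidal functor, i.e. the unit and the laxator of `T` lie over identities. -/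
structure LaxMonoidalSection (π : E ⥤ B) (T : B ⥤ E) where
  section_eq : T ⋙ π = 𝟭 B
  laxBraided : T.LaxBraided
  ε_over : π.IsHomLift (𝟙 (𝟙_ B)) (Functor.LaxMonoidal.ε T)
  μ_over (b b' : B) : π.IsHomLift (𝟙 (b ⊗ b')) (Functor.LaxMonoidal.μ T b b')

end

/-- The structure, on given categories and functors `π : E ⥤ B` and `T : B ⥤ E`, of a symmetric
monoidal fibration together with a lax symmetric monoidal section. -/
structure SymmetricMonoidalFibrationWithSection {E B : Type u} [Category.{v} E]
    [Category.{v} B] (π : E ⥤ B) (T : B ⥤ E) where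
  [monoidalTotal : MonoidalCategory E]
  [symmetricTotal : SymmetricCategory E]
  [monoidalBase : MonoidalCategory B]
  [symmetricBase : SymmetricCategory B]
  fibration : SymmetricMonoidalFibration π
  laxSection : LaxMonoidalSection π T

open Tangency in
/-- A symmetric pseudomonoid structure on a tangency `(π : E ⥤ B, T)` and symmetric monoidal
structures on `E`, `B` and a lax monoidal structure on `T` have the same underlying data:
tensor functors, units, associators, unitors, symmetries, laxator and lax unit.
(`HEq` only bridges the equalities between tensor products.) -/
structure SameData {X : Tangency.{v, u}} (M : SymmetricPseudomonoid X)
    [MonoidalCategory X.Total] [SymmetricCategory X.Total]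
    [MonoidalCategory X.Base] [SymmetricCategory X.Base] [X.sec.LaxBraided] : Prop where
  tensor_base : Hom.base M.mul = tensor X.Base
  tensor_total : Hom.total M.mul = tensor X.Total
  unit_base : (Hom.base M.one).obj ⟨⟩ = 𝟙_ X.Base
  unit_total : (Hom.total M.one).obj ⟨⟩ = 𝟙_ X.Total
  associator_base (a b c : X.Base) :
    HEq ((Hom₂.base M.associator.hom).app ((a, b), c)) (α_ a b c).hom
  associator_total (x y z : X.Total) :
    HEq ((Hom₂.total M.associator.hom).app ((x, y), z)) (α_ x y z).hom
  leftUnitor_base (a : X.Base) : HEq ((Hom₂.base M.leftUnitor.hom).app a) (λ_ a).hom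
  leftUnitor_total (x : X.Total) : HEq ((Hom₂.total M.leftUnitor.hom).app x) (λ_ x).hom
  rightUnitor_base (a : X.Base) : HEq ((Hom₂.base M.rightUnitor.hom).app a) (ρ_ a).hom
  rightUnitor_total (x : X.Total) : HEq ((Hom₂.total M.rightUnitor.hom).app x) (ρ_ x).hom
  braiding_base (a b : X.Base) : HEq ((Hom₂.base M.braiding.hom).app (a, b)) (β_ a b).hom
  braiding_total (x y : X.Total) :
    HEq ((Hom₂.total M.braiding.hom).app (x, y)) (β_ x y).hom
  lax_tensor (a b : X.Base) :
    HEq ((Hom.comparison M.mul).app (a, b)) (Functor.LaxMonoidal.μ X.sec a b)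
  lax_unit : HEq ((Hom.comparison M.one).app ⟨⟩) (Functor.LaxMonoidal.ε X.sec)

/-- `SameData` for a bundled symmetric monoidal fibration with lax monoidal section. -/
def Corresponds {X : Tangency.{v, u}} (M : SymmetricPseudomonoid X)
    (N : SymmetricMonoidalFibrationWithSection X.proj X.sec) : Prop :=
  letI := N.monoidalTotal
  letI := N.symmetricTotal
  letI := N.monoidalBase
  letI := N.symmetricBase
  letI := N.laxSection.laxBraided
  SameData M

end Tangencies

/-! ### Components of 2-cells of tangencies -/

namespace Tangency

open Tangencies CartesianTwoCategory

/-! Products and composition in the 2-category of tangencies are componentwise, and a 2-cell is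
determined by its base and total components. A symmetric pseudomonoid is therefore a pair of
symmetric monoidal structures, one on `B` and one on `E`, together with what it costs for the pair
to live in tangencies, and each cost is one clause of the monoidal description. The squares of the
multiplication and unit commute strictly, and the structural 2-cells lie over their base components:
this says that `π` is strict symmetric monoidal. The multiplication preserves cartesian arrows: this
is the condition on the tensor product of `E`. The comparisons of multiplication and unit are the
laxator and lax unit, lying over identities. Finally, compatibility of the associator, unitors and
symmetry with the comparisons is exactly associativity, unitality and symmetry of the lax functor
`T`.

The axioms are transferred by evaluation: at projections of powers of `X` they become the usual
equations between objects, and conversely a pointwise check gives them at all generalised elements.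
The lemmas `assocAt_base_app`, `mulMap_base_app` and their variants make this possible, by showing
that the `eqToHom`s in the 2-categorical formulation vanish on components. The lemmas
`comparison_mulAt_mulAt_left` and its companions do the same for the comparisons.

The bijection comes from the relation `Corresponds`, which is total and single-valued in both
directions. Single-valuedness rests on strictness: it fixes the monoidal structure of `π` completely
(`SymmetricMonoidalFibration.subsingleton`), so that nothing is recorded beyond the shared data. -/

/-- The functor sending a morphism of tangencies to its functor between the bases. -/
def baseFunctor (X Y : Tangency.{v, u}) : (X ⟶ Y) ⥤ (X.Base ⥤ Y.Base) where
  obj F := Hom.base F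
  map η := Hom₂.base η

/-- The functor sending a morphism of tangencies to its functor between the total categories. -/
def totalFunctor (X Y : Tangency.{v, u}) : (X ⟶ Y) ⥤ (X.Total ⥤ Y.Total) where
  obj F := Hom.total F
  map η := Hom₂.total η

theorem comp_base_app {X Y : Tangency.{v, u}} {F G H : X ⟶ Y} (η : F ⟶ G) (θ : G ⟶ H)
    (b : X.Base) : (Hom₂.base (η ≫ θ)).app b = (Hom₂.base η).app b ≫ (Hom₂.base θ).app b :=
  rfl

theorem comp_total_app {X Y : Tangency.{v, u}} {F G H : X ⟶ Y} (η : F ⟶ G) (θ : G ⟶ H)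
    (e : X.Total) : (Hom₂.total (η ≫ θ)).app e = (Hom₂.total η).app e ≫ (Hom₂.total θ).app e :=
  rfl

section Components

variable {X Z : Tangency.{v, u}}

/-- Transport along an equality of 1-cells is invisible on components. The statement is
heterogeneous because the endpoints agree only propositionally in general; in the uses below the
components of the 1-cells agree by definition, and `eq_of_heq` turns it into an equality. -/
theorem eqToHom_comp_base_app {F F' G G' : X ⟶ Z} (hF : F = F') (hG : G' = G) (η : F' ⟶ G')
    (b : X.Base) : HEq ((Hom₂.base (eqToHom hF ≫ η ≫ eqToHom hG)).app b) ((Hom₂.base η).app b) := by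
  subst hF hG
  simp

theorem eqToHom_comp_total_app {F F' G G' : X ⟶ Z} (hF : F = F') (hG : G' = G) (η : F' ⟶ G')
    (e : X.Total) :
    HEq ((Hom₂.total (eqToHom hF ≫ η ≫ eqToHom hG)).app e) ((Hom₂.total η).app e) := by
  subst hF hG
  simp

theorem mulMap_base_app (m : prod X X ⟶ X) {f f' g g' : Z ⟶ X} (η : f ⟶ f') (θ : g ⟶ g')
    (z : Z.Base) :
    (Hom₂.base (mulMap m η θ)).app z =
      (Hom.base m).map (((Hom₂.base η).app z, (Hom₂.base θ).app z) :
        ((Hom.base f).obj z, (Hom.base g).obj z) ⟶ ((Hom.base f').obj z, (Hom.base g').obj z)) :=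
  congrArg (fun k => (Hom.base m).map k) (Prod.ext
    (eq_of_heq (eqToHom_comp_base_app (lift_fst f g) (lift_fst f' g').symm η z))
    (eq_of_heq (eqToHom_comp_base_app (lift_snd f g) (lift_snd f' g').symm θ z)))

theorem mulMap_total_app (m : prod X X ⟶ X) {f f' g g' : Z ⟶ X} (η : f ⟶ f') (θ : g ⟶ g')
    (z : Z.Total) :
    (Hom₂.total (mulMap m η θ)).app z =
      (Hom.total m).map (((Hom₂.total η).app z, (Hom₂.total θ).app z) :
        ((Hom.total f).obj z, (Hom.total g).obj z) ⟶
          ((Hom.total f').obj z, (Hom.total g').obj z)) :=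
  congrArg (fun k => (Hom.total m).map k) (Prod.ext
    (eq_of_heq (eqToHom_comp_total_app (lift_fst f g) (lift_fst f' g').symm η z))
    (eq_of_heq (eqToHom_comp_total_app (lift_snd f g) (lift_snd f' g').symm θ z)))

variable (M : SymmetricPseudomonoidData X)

theorem assocAt_base_app (f g h : Z ⟶ X) (z : Z.Base) :
    (Hom₂.base (M.assocAt f g h)).app z = (Hom₂.base M.associator.hom).app
      (((Hom.base f).obj z, (Hom.base g).obj z), (Hom.base h).obj z) :=
  eq_of_heq (eqToHom_comp_base_app _ _ _ z)

theorem assocAt_total_app (f g h : Z ⟶ X) (z : Z.Total) :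
    (Hom₂.total (M.assocAt f g h)).app z = (Hom₂.total M.associator.hom).app
      (((Hom.total f).obj z, (Hom.total g).obj z), (Hom.total h).obj z) :=
  eq_of_heq (eqToHom_comp_total_app _ _ _ z)

theorem leftUnitorAt_base_app (f : Z ⟶ X) (z : Z.Base) :
    (Hom₂.base (M.leftUnitorAt f)).app z =
      (Hom₂.base M.leftUnitor.hom).app ((Hom.base f).obj z) :=
  eq_of_heq (eqToHom_comp_base_app _ _ _ z)

theorem leftUnitorAt_total_app (f : Z ⟶ X) (z : Z.Total) :
    (Hom₂.total (M.leftUnitorAt f)).app z =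
      (Hom₂.total M.leftUnitor.hom).app ((Hom.total f).obj z) :=
  eq_of_heq (eqToHom_comp_total_app _ _ _ z)

theorem rightUnitorAt_base_app (f : Z ⟶ X) (z : Z.Base) :
    (Hom₂.base (M.rightUnitorAt f)).app z =
      (Hom₂.base M.rightUnitor.hom).app ((Hom.base f).obj z) :=
  eq_of_heq (eqToHom_comp_base_app _ _ _ z)

theorem rightUnitorAt_total_app (f : Z ⟶ X) (z : Z.Total) :
    (Hom₂.total (M.rightUnitorAt f)).app z =
      (Hom₂.total M.rightUnitor.hom).app ((Hom.total f).obj z) :=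
  eq_of_heq (eqToHom_comp_total_app _ _ _ z)

theorem braidingAt_base_app (f g : Z ⟶ X) (z : Z.Base) :
    (Hom₂.base (M.braidingAt f g)).app z =
      (Hom₂.base M.braiding.hom).app ((Hom.base f).obj z, (Hom.base g).obj z) :=
  eq_of_heq (eqToHom_comp_base_app _ _ _ z)

theorem braidingAt_total_app (f g : Z ⟶ X) (z : Z.Total) :
    (Hom₂.total (M.braidingAt f g)).app z =
      (Hom₂.total M.braiding.hom).app ((Hom.total f).obj z, (Hom.total g).obj z) :=
  eq_of_heq (eqToHom_comp_total_app _ _ _ z)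

end Components

end Tangency

/-! ### Symmetric monoidal structures presented by a tensor functor -/

namespace Tangencies

/-- A symmetric monoidal structure on a category presented by its tensor functor: the unbundled
form in which it appears in a symmetric pseudomonoid. -/
structure SymmetricTensor (C : Type u) [Category.{v} C] where
  /-- the tensor functor -/
  tensor : C × C ⥤ C
  /-- the unit object -/
  unit : C
  /-- the associator -/
  associator (a b c : C) : tensor.obj (tensor.obj (a, b), c) ≅ tensor.obj (a, tensor.obj (b, c))
  /-- the left unitor -/
  leftUnitor (a : C) : tensor.obj (unit, a) ≅ a
  /-- the right unitor -/
  rightUnitor (a : C) : tensor.obj (a, unit) ≅ a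
  /-- the symmetry -/
  braiding (a b : C) : tensor.obj (a, b) ≅ tensor.obj (b, a)
  associator_naturality {a b c a' b' c' : C} (f : a ⟶ a') (g : b ⟶ b') (h : c ⟶ c') :
    tensor.map ((tensor.map ((f, g) : (a, b) ⟶ (a', b')), h) :
        (tensor.obj (a, b), c) ⟶ (tensor.obj (a', b'), c')) ≫ (associator a' b' c').hom =
      (associator a b c).hom ≫ tensor.map ((f, tensor.map ((g, h) : (b, c) ⟶ (b', c'))) :
        (a, tensor.obj (b, c)) ⟶ (a', tensor.obj (b', c')))
  leftUnitor_naturality {a a' : C} (f : a ⟶ a') :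
    tensor.map ((𝟙 unit, f) : (unit, a) ⟶ (unit, a')) ≫ (leftUnitor a').hom =
      (leftUnitor a).hom ≫ f
  rightUnitor_naturality {a a' : C} (f : a ⟶ a') :
    tensor.map ((f, 𝟙 unit) : (a, unit) ⟶ (a', unit)) ≫ (rightUnitor a').hom =
      (rightUnitor a).hom ≫ f
  braiding_naturality {a b a' b' : C} (f : a ⟶ a') (g : b ⟶ b') :
    tensor.map ((f, g) : (a, b) ⟶ (a', b')) ≫ (braiding a' b').hom =
      (braiding a b).hom ≫ tensor.map ((g, f) : (b, a) ⟶ (b', a'))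
  pentagon (a b c d : C) :
    tensor.map (((associator a b c).hom, 𝟙 d) :
        (tensor.obj (tensor.obj (a, b), c), d) ⟶ (tensor.obj (a, tensor.obj (b, c)), d)) ≫
      (associator a (tensor.obj (b, c)) d).hom ≫
        tensor.map ((𝟙 a, (associator b c d).hom) :
          (a, tensor.obj (tensor.obj (b, c), d)) ⟶ (a, tensor.obj (b, tensor.obj (c, d)))) =
      (associator (tensor.obj (a, b)) c d).hom ≫ (associator a b (tensor.obj (c, d))).hom
  triangle (a b : C) :
    (associator a unit b).hom ≫
        tensor.map ((𝟙 a, (leftUnitor b).hom) : (a, tensor.obj (unit, b)) ⟶ (a, b)) =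
      tensor.map (((rightUnitor a).hom, 𝟙 b) : (tensor.obj (a, unit), b) ⟶ (a, b))
  hexagon (a b c : C) :
    (associator a b c).hom ≫ (braiding a (tensor.obj (b, c))).hom ≫ (associator b c a).hom =
      tensor.map (((braiding a b).hom, 𝟙 c) :
          (tensor.obj (a, b), c) ⟶ (tensor.obj (b, a), c)) ≫
        (associator b a c).hom ≫ tensor.map ((𝟙 b, (braiding a c).hom) :
          (b, tensor.obj (a, c)) ⟶ (b, tensor.obj (c, a)))
  symmetry (a b : C) : (braiding a b).hom ≫ (braiding b a).hom = 𝟙 _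

namespace SymmetricTensor

open MonoidalCategory

variable {C : Type u} [Category.{v} C] (S : SymmetricTensor C)

/-- The monoidal category given by a tensor functor. -/
abbrev monoidalCategory : MonoidalCategory C :=
  letI : MonoidalCategoryStruct C :=
    { tensorObj := fun a b => S.tensor.obj (a, b)
      whiskerLeft := fun a _ _ g => S.tensor.map (𝟙 a, g)
      whiskerRight := fun f b => S.tensor.map (f, 𝟙 b)
      tensorHom := fun f g => S.tensor.map (f, g)
      tensorUnit := S.unit
      associator := S.associator
      leftUnitor := S.leftUnitor
      rightUnitor := S.rightUnitor }
  .ofTensorHom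
    (id_tensorHom_id := fun a b => S.tensor.map_id (a, b))
    (id_tensorHom := fun _ _ _ _ => rfl)
    (tensorHom_id := fun _ _ => rfl)
    (tensorHom_comp_tensorHom := fun _ _ _ _ => (S.tensor.map_comp _ _).symm)
    (associator_naturality := S.associator_naturality)
    (leftUnitor_naturality := S.leftUnitor_naturality)
    (rightUnitor_naturality := S.rightUnitor_naturality)
    (pentagon := S.pentagon)
    (triangle := S.triangle)

/-- The symmetry on the monoidal category given by a tensor functor. -/
abbrev symmetricCategory : letI := S.monoidalCategory; SymmetricCategory C :=
  letI := S.monoidalCategory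
  { braiding := S.braiding
    braiding_naturality_right := fun a _ _ g => S.braiding_naturality (𝟙 a) g
    braiding_naturality_left := fun f b => S.braiding_naturality f (𝟙 b)
    hexagon_forward := S.hexagon
    -- The reverse hexagon at `(a, b, c)` is the inverse of the forward hexagon at `(c, a, b)`,
    -- since the inverse of a symmetry is the symmetry with its arguments exchanged.
    hexagon_reverse := fun a b c => by
      have key (x y : C) : (S.braiding x y).hom = (S.braiding y x).inv :=
        Iso.inv_ext' (S.symmetry y x)
      have h : α_ c a b ≪≫ S.braiding c (a ⊗ b) ≪≫ α_ a b c =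
          whiskerRightIso (S.braiding c a) b ≪≫ α_ a c b ≪≫ whiskerLeftIso a (S.braiding c b) :=
        Iso.ext (S.hexagon c a b)
      have h' := congrArg Iso.inv h
      simp only [Iso.trans_inv, Category.assoc, MonoidalCategory.whiskerRightIso_inv,
        MonoidalCategory.whiskerLeftIso_inv, ← key] at h'
      exact h'
    symmetry := S.symmetry }

end SymmetricTensor

end Tangencies

/-! ### Strict symmetric monoidal functors -/

namespace Tangencies

open MonoidalCategory

section StrictMonoidal

variable {E B : Type u} [Category.{v} E] [Category.{v} B]
  [MonoidalCategory E] [SymmetricCategory E] [MonoidalCategory B] [SymmetricCategory B]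

/-- A functor over which tensor products, units and structure isomorphisms lie strictly is a
braided monoidal functor. -/
abbrev braidedOfIsHomLift (π : E ⥤ B) (hε : 𝟙_ B = π.obj (𝟙_ E))
    (hμ : ∀ x y, π.obj x ⊗ π.obj y = π.obj (x ⊗ y))
    (hf : ∀ {x y x' y' : E} (f : x ⟶ y) (g : x' ⟶ y'),
      π.IsHomLift (π.map f ⊗ₘ π.map g) (f ⊗ₘ g))
    (hα : ∀ x y z, π.IsHomLift (α_ (π.obj x) (π.obj y) (π.obj z)).hom (α_ x y z).hom)
    (hl : ∀ x, π.IsHomLift (λ_ (π.obj x)).hom (λ_ x).hom)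
    (hr : ∀ x, π.IsHomLift (ρ_ (π.obj x)).hom (ρ_ x).hom)
    (hβ : ∀ x y, π.IsHomLift (β_ (π.obj x) (π.obj y)).hom (β_ x y).hom) : π.Braided :=
  letI core : π.CoreMonoidal :=
    { εIso := eqToIso hε
      μIso := fun x y => eqToIso (hμ x y)
      μIso_hom_natural_left := fun f x => by
        -- Whiskering is tensoring with an identity. By `fac'`, the image of a lift is the base
        -- arrow conjugated by `eqToHom`s; here and in the remaining axioms these cancel against the
        -- structure isomorphisms.
        have := hf f (𝟙 x)
        have := IsHomLift.fac' π (π.map f ⊗ₘ π.map (𝟙 x)) (f ⊗ₘ 𝟙 x)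
        simp at this
        simp [this]
      μIso_hom_natural_right := fun {_ _} x f => by
        have := hf (𝟙 x) f
        have := IsHomLift.fac' π (π.map (𝟙 x) ⊗ₘ π.map f) (𝟙 x ⊗ₘ f)
        simp at this
        simp [this]
      associativity := fun x y z => by
        have := hα x y z
        rw [IsHomLift.fac' π (α_ (π.obj x) (π.obj y) (π.obj z)).hom (α_ x y z).hom]
        simp [MonoidalCategory.whiskerLeft_eqToHom, MonoidalCategory.eqToHom_whiskerRight]
      left_unitality := fun x => by
        have := hl x
        rw [IsHomLift.fac' π (λ_ (π.obj x)).hom (λ_ x).hom]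
        simp [MonoidalCategory.eqToHom_whiskerRight]
      right_unitality := fun x => by
        have := hr x
        rw [IsHomLift.fac' π (ρ_ (π.obj x)).hom (ρ_ x).hom]
        simp [MonoidalCategory.whiskerLeft_eqToHom] }
  { core.toMonoidal with
    braided := fun x y => by
      have := hβ x y
      rw [IsHomLift.fac' π (β_ (π.obj x) (π.obj y)).hom (β_ x y).hom]
      change (eqToIso (hμ x y)).hom ≫ _ = _ ≫ (eqToIso (hμ y x)).hom
      simp }

namespace SymmetricMonoidalFibration

variable {π : E ⥤ B}

theorem obj_unit (P : SymmetricMonoidalFibration π) : π.obj (𝟙_ E) = 𝟙_ B := P.ε_strict.1.symm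

theorem obj_tensor (P : SymmetricMonoidalFibration π) (x y : E) : π.obj (x ⊗ y) = π.obj x ⊗ π.obj y := (P.μ_strict x y).1.symm

theorem ε_eq (P : SymmetricMonoidalFibration π) : letI := P.braided; Functor.LaxMonoidal.ε π = eqToHom P.obj_unit.symm := P.ε_strict.2

theorem μ_eq (P : SymmetricMonoidalFibration π) (x y : E) : letI := P.braided; Functor.LaxMonoidal.μ π x y = eqToHom (P.obj_tensor x y).symm :=
  (P.μ_strict x y).2

/-- Strictness is imposed on the lax structure only; the oplax unit is inverse to the lax one, so it
is an `eqToHom` as well. -/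
theorem η_eq (P : SymmetricMonoidalFibration π) : letI := P.braided; Functor.OplaxMonoidal.η π = eqToHom P.obj_unit := by
  let := P.braided
  rw [← cancel_epi (Functor.LaxMonoidal.ε π), Functor.Monoidal.ε_η, P.ε_eq, eqToHom_trans, eqToHom_refl]

theorem δ_eq (P : SymmetricMonoidalFibration π) (x y : E) : letI := P.braided; Functor.OplaxMonoidal.δ π x y = eqToHom (P.obj_tensor x y) := by
  let := P.braided
  rw [← cancel_epi (Functor.LaxMonoidal.μ π x y), Functor.Monoidal.μ_δ, P.μ_eq, eqToHom_trans, eqToHom_refl]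

/-- The form with `eqToHom` on both sides is what `Functor.ext` asks for when the square of the
multiplication is shown to commute. -/
theorem map_tensor (P : SymmetricMonoidalFibration π) {x y x' y' : E} (f : x ⟶ y) (g : x' ⟶ y') :
    π.map (f ⊗ₘ g) = eqToHom (P.obj_tensor x x') ≫ (π.map f ⊗ₘ π.map g) ≫
      eqToHom (P.obj_tensor y y').symm := by
  let := P.braided
  rw [Functor.Monoidal.map_tensor, P.δ_eq, P.μ_eq]

/-- Coherence of a monoidal functor expresses the image of the associator through `μ` and `δ`. When
these are `eqToHom`s, the image is the associator of the base up to transport, which is the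
condition for a 2-cell to lie over its base component. -/
theorem associator_isHomLift (P : SymmetricMonoidalFibration π) (x y z : E) :
    π.IsHomLift (α_ (π.obj x) (π.obj y) (π.obj z)).hom (α_ x y z).hom := by
  let := P.braided
  refine IsHomLift.of_fac' _ _ _ (by rw [P.obj_tensor, P.obj_tensor])
    (by rw [P.obj_tensor, P.obj_tensor]) ?_
  rw [Functor.Monoidal.map_associator, P.δ_eq, P.δ_eq, P.μ_eq, P.μ_eq]
  simp [MonoidalCategory.whiskerLeft_eqToHom, MonoidalCategory.eqToHom_whiskerRight]

theorem leftUnitor_isHomLift (P : SymmetricMonoidalFibration π) (x : E) : π.IsHomLift (λ_ (π.obj x)).hom (λ_ x).hom := by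
  let := P.braided
  refine IsHomLift.of_fac' _ _ _ (by rw [P.obj_tensor, P.obj_unit]) rfl ?_
  rw [Functor.Monoidal.map_leftUnitor, P.δ_eq, P.η_eq]
  simp [MonoidalCategory.eqToHom_whiskerRight]

theorem rightUnitor_isHomLift (P : SymmetricMonoidalFibration π) (x : E) : π.IsHomLift (ρ_ (π.obj x)).hom (ρ_ x).hom := by
  let := P.braided
  refine IsHomLift.of_fac' _ _ _ (by rw [P.obj_tensor, P.obj_unit]) rfl ?_
  rw [Functor.Monoidal.map_rightUnitor, P.δ_eq, P.η_eq]
  simp [MonoidalCategory.whiskerLeft_eqToHom]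

theorem braiding_isHomLift (P : SymmetricMonoidalFibration π) (x y : E) :
    π.IsHomLift (β_ (π.obj x) (π.obj y)).hom (β_ x y).hom := by
  let := P.braided
  refine IsHomLift.of_fac' _ _ _ (P.obj_tensor _ _) (P.obj_tensor _ _) ?_
  rw [Functor.map_braiding, P.δ_eq, P.μ_eq]

/-- Strictness determines `ε` and `μ`, hence their inverses `η` and `δ`; everything else is a
proposition. Being a symmetric monoidal fibration is thus a property of `π`. -/
theorem subsingleton : Subsingleton (SymmetricMonoidalFibration π) where
  allEq P Q := by
    -- The equalities are proved before the structures are taken apart, so that they become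
    -- equations between free variables and can be substituted.
    have hε := P.ε_eq.trans Q.ε_eq.symm
    have hμ := fun x y => (P.μ_eq x y).trans (Q.μ_eq x y).symm
    have hη := P.η_eq.trans Q.η_eq.symm
    have hδ := fun x y => (P.δ_eq x y).trans (Q.δ_eq x y).symm
    obtain ⟨_, @⟨@⟨⟨_, _, _, _, _, _, _⟩, ⟨_, _, _, _, _, _, _⟩, _, _, _, _⟩, _⟩, _, _, _⟩ := P
    obtain ⟨_, @⟨@⟨⟨_, _, _, _, _, _, _⟩, ⟨_, _, _, _, _, _, _⟩, _, _, _, _⟩, _⟩, _, _, _⟩ := Q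
    obtain rfl := hε
    obtain rfl := hη
    obtain rfl := funext fun x => funext fun y => hμ x y
    obtain rfl := funext fun x => funext fun y => hδ x y
    rfl

end SymmetricMonoidalFibration

end StrictMonoidal

end Tangencies

/-! ### Monoidal structures on base and total category from a pseudomonoid -/

namespace Tangencies

open CartesianTwoCategory
open Tangency hiding prod fst snd lift lift₂ terminal toTerminal

namespace SymmetricPseudomonoid

variable {X : Tangency.{v, u}} (M : SymmetricPseudomonoid X)

/-- The first projection of the fourfold product. -/
abbrev proj₁ (X : Tangency.{v, u}) : prod (prod (prod X X) X) X ⟶ X := fst ≫ fst ≫ fst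

/-- The second projection of the fourfold product. -/
abbrev proj₂ (X : Tangency.{v, u}) : prod (prod (prod X X) X) X ⟶ X := fst ≫ fst ≫ snd

/-- The third projection of the fourfold product. -/
abbrev proj₃ (X : Tangency.{v, u}) : prod (prod (prod X X) X) X ⟶ X := fst ≫ snd

/-- The fourth projection of the fourfold product. -/
abbrev proj₄ (X : Tangency.{v, u}) : prod (prod (prod X X) X) X ⟶ X := snd

theorem ext_app_base {Y Z : Tangency.{v, u}} {F G : Y ⟶ Z} {η θ : F ⟶ G} (h : η = θ)
    (b : Y.Base) : (Hom₂.base η).app b = (Hom₂.base θ).app b := by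
  rw [h]

theorem ext_app_total {Y Z : Tangency.{v, u}} {F G : Y ⟶ Z} {η θ : F ⟶ G} (h : η = θ)
    (e : Y.Total) : (Hom₂.total η).app e = (Hom₂.total θ).app e := by
  rw [h]

/-- The symmetric monoidal structure on the base of a symmetric pseudomonoid. -/
abbrev baseTensor : SymmetricTensor X.Base where
  tensor := Hom.base M.mul
  unit := (Hom.base M.one).obj ⟨⟩
  associator a b c := ((baseFunctor _ _).mapIso M.associator).app ((a, b), c)
  leftUnitor a := ((baseFunctor _ _).mapIso M.leftUnitor).app a
  rightUnitor a := ((baseFunctor _ _).mapIso M.rightUnitor).app a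
  braiding a b := ((baseFunctor _ _).mapIso M.braiding).app (a, b)
  associator_naturality {a b c a' b' c'} f g h :=
    (Hom₂.base M.associator.hom).naturality (((f, g), h) : ((a, b), c) ⟶ ((a', b'), c'))
  leftUnitor_naturality f := by
    have := (Hom₂.base M.leftUnitor.hom).naturality f
    -- In the naturality square the unit factor is the image under the unit functor of the identity
    -- of the point, so `𝟙 unit` is put in that form.
    rw [← CategoryTheory.Functor.map_id]
    exact this
  rightUnitor_naturality f := by
    have := (Hom₂.base M.rightUnitor.hom).naturality f
    rw [← CategoryTheory.Functor.map_id]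
    exact this
  braiding_naturality {a b a' b'} f g :=
    (Hom₂.base M.braiding.hom).naturality ((f, g) : (a, b) ⟶ (a', b'))
  pentagon a b c d := by
    -- At the point `(((a, b), c), d)` the four projections take the values `a`, `b`, `c`, `d`, so
    -- the universal instance of the axiom is the ordinary pentagon.
    have := ext_app_base (M.pentagon (proj₁ X) (proj₂ X) (proj₃ X) (proj₄ X)) (((a, b), c), d)
    simp only [comp_base_app, mulMap_base_app, assocAt_base_app] at this
    exact this
  triangle a b := by
    have := ext_app_base (M.triangle (fst : prod X X ⟶ X) snd) (a, b)
    simp only [comp_base_app, mulMap_base_app, assocAt_base_app, leftUnitorAt_base_app,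
      rightUnitorAt_base_app] at this
    exact this
  hexagon a b c := by
    have := ext_app_base (M.hexagon (fst ≫ fst : prod (prod X X) X ⟶ X) (fst ≫ snd) snd)
      ((a, b), c)
    simp only [comp_base_app, mulMap_base_app, assocAt_base_app, braidingAt_base_app] at this
    exact this
  symmetry a b := by
    have := ext_app_base (M.symmetry (fst : prod X X ⟶ X) snd) (a, b)
    simp only [comp_base_app, braidingAt_base_app] at this
    exact this

/-- The symmetric monoidal structure on the total category of a symmetric pseudomonoid. -/
abbrev totalTensor : SymmetricTensor X.Total where
  tensor := Hom.total M.mul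
  unit := (Hom.total M.one).obj ⟨⟩
  associator a b c := ((totalFunctor _ _).mapIso M.associator).app ((a, b), c)
  leftUnitor a := ((totalFunctor _ _).mapIso M.leftUnitor).app a
  rightUnitor a := ((totalFunctor _ _).mapIso M.rightUnitor).app a
  braiding a b := ((totalFunctor _ _).mapIso M.braiding).app (a, b)
  associator_naturality {a b c a' b' c'} f g h :=
    (Hom₂.total M.associator.hom).naturality (((f, g), h) : ((a, b), c) ⟶ ((a', b'), c'))
  leftUnitor_naturality f := by
    have := (Hom₂.total M.leftUnitor.hom).naturality f
    rw [← CategoryTheory.Functor.map_id]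
    exact this
  rightUnitor_naturality f := by
    have := (Hom₂.total M.rightUnitor.hom).naturality f
    rw [← CategoryTheory.Functor.map_id]
    exact this
  braiding_naturality {a b a' b'} f g :=
    (Hom₂.total M.braiding.hom).naturality ((f, g) : (a, b) ⟶ (a', b'))
  pentagon a b c d := by
    have := ext_app_total (M.pentagon (proj₁ X) (proj₂ X) (proj₃ X) (proj₄ X)) (((a, b), c), d)
    simp only [comp_total_app, mulMap_total_app, assocAt_total_app] at this
    exact this
  triangle a b := by
    have := ext_app_total (M.triangle (fst : prod X X ⟶ X) snd) (a, b)
    simp only [comp_total_app, mulMap_total_app, assocAt_total_app, leftUnitorAt_total_app,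
      rightUnitorAt_total_app] at this
    exact this
  hexagon a b c := by
    have := ext_app_total (M.hexagon (fst ≫ fst : prod (prod X X) X ⟶ X) (fst ≫ snd) snd)
      ((a, b), c)
    simp only [comp_total_app, mulMap_total_app, assocAt_total_app, braidingAt_total_app] at this
    exact this
  symmetry a b := by
    have := ext_app_total (M.symmetry (fst : prod X X ⟶ X) snd) (a, b)
    simp only [comp_total_app, braidingAt_total_app] at this
    exact this

end SymmetricPseudomonoid

end Tangencies

/-! ### Lax monoidal section from a pseudomonoid -/

namespace Tangencies

open CartesianTwoCategory
open Tangency hiding prod fst snd lift lift₂ terminal toTerminal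

section Comparison

variable {X : Tangency.{v, u}} (m : prod X X ⟶ X) (i : terminal ⟶ X)

/-- The comparison of a composite is the image of the first comparison followed by the second, and
projections contribute identities. This lemma and the five after it compute the composites of
laxators and lax units occurring in the axioms of a lax symmetric monoidal functor. -/
theorem comparison_mulAt_mulAt_left (a b c : X.Base) :
    (Hom.comparison (mulAt m (mulAt m (fst ≫ fst) (fst ≫ snd)) snd)).app ((a, b), c) =
      (Hom.total m).map (((Hom.comparison m).app (a, b), 𝟙 (X.sec.obj c)) :
        ((Hom.total m).obj (X.sec.obj a, X.sec.obj b), X.sec.obj c) ⟶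
          (X.sec.obj ((Hom.base m).obj (a, b)), X.sec.obj c)) ≫
        (Hom.comparison m).app ((Hom.base m).obj (a, b), c) := by
  refine congrArg (fun k => (Hom.total m).map k ≫ (Hom.comparison m).app _) (Prod.ext ?_ rfl)
  -- The factors `𝟙 _ ≫ 𝟙 _` are the comparisons of the composite projections `fst ≫ fst` and `fst ≫
  -- snd`.
  change (Hom.total m).map (((𝟙 _ ≫ 𝟙 _, 𝟙 _ ≫ 𝟙 _) : (X.sec.obj a, X.sec.obj b) ⟶ _)) ≫
    (Hom.comparison m).app (a, b) = _
  rw [Category.id_comp, Category.id_comp]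
  exact (congrArg (· ≫ _) ((Hom.total m).map_id _)).trans (Category.id_comp _)

theorem comparison_mulAt_mulAt_right (a b c : X.Base) :
    (Hom.comparison (mulAt m (fst ≫ fst) (mulAt m (fst ≫ snd) snd))).app ((a, b), c) =
      (Hom.total m).map ((𝟙 (X.sec.obj a), (Hom.comparison m).app (b, c)) :
        (X.sec.obj a, (Hom.total m).obj (X.sec.obj b, X.sec.obj c)) ⟶
          (X.sec.obj a, X.sec.obj ((Hom.base m).obj (b, c)))) ≫
        (Hom.comparison m).app (a, (Hom.base m).obj (b, c)) := by
  refine congrArg (fun k => (Hom.total m).map k ≫ (Hom.comparison m).app _)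
    (Prod.ext (Category.id_comp (𝟙 _)) ?_)
  change (Hom.total m).map (((𝟙 _ ≫ 𝟙 _, 𝟙 _) : (X.sec.obj b, X.sec.obj c) ⟶ _)) ≫
    (Hom.comparison m).app (b, c) = _
  rw [Category.id_comp]
  exact (congrArg (· ≫ _) ((Hom.total m).map_id _)).trans (Category.id_comp _)

theorem comparison_mulAt_one_left (a : X.Base) :
    (Hom.comparison (mulAt m (oneAt i X) (𝟙 X))).app a =
      (Hom.total m).map (((Hom.comparison i).app ⟨⟩, 𝟙 (X.sec.obj a)) :
        ((Hom.total i).obj ⟨⟩, X.sec.obj a) ⟶ (X.sec.obj ((Hom.base i).obj ⟨⟩), X.sec.obj a)) ≫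
        (Hom.comparison m).app ((Hom.base i).obj ⟨⟩, a) := by
  refine congrArg (fun k => (Hom.total m).map k ≫ (Hom.comparison m).app _) (Prod.ext ?_ rfl)
  -- `oneAt` factors through the terminal tangency, where the comparison is an identity and is sent
  -- to an identity by the unit functor.
  exact (congrArg (· ≫ _) ((Hom.total i).map_id _)).trans (Category.id_comp _)

theorem comparison_mulAt_one_right (a : X.Base) :
    (Hom.comparison (mulAt m (𝟙 X) (oneAt i X))).app a =
      (Hom.total m).map ((𝟙 (X.sec.obj a), (Hom.comparison i).app ⟨⟩) :
        (X.sec.obj a, (Hom.total i).obj ⟨⟩) ⟶ (X.sec.obj a, X.sec.obj ((Hom.base i).obj ⟨⟩))) ≫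
        (Hom.comparison m).app (a, (Hom.base i).obj ⟨⟩) := by
  refine congrArg (fun k => (Hom.total m).map k ≫ (Hom.comparison m).app _) (Prod.ext rfl ?_)
  exact (congrArg (· ≫ _) ((Hom.total i).map_id _)).trans (Category.id_comp _)

theorem comparison_mulAt_fst_snd (a b : X.Base) :
    (Hom.comparison (mulAt m fst snd)).app (a, b) = (Hom.comparison m).app (a, b) :=
  (congrArg (· ≫ _) ((Hom.total m).map_id _)).trans (Category.id_comp _)

theorem comparison_mulAt_snd_fst (a b : X.Base) :
    (Hom.comparison (mulAt m snd fst)).app (a, b) = (Hom.comparison m).app (b, a) :=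
  (congrArg (· ≫ _) ((Hom.total m).map_id _)).trans (Category.id_comp _)

end Comparison

namespace SymmetricPseudomonoid

variable {X : Tangency.{v, u}} (M : SymmetricPseudomonoid X)

/-- The symmetric monoidal fibration underlying a symmetric pseudomonoid. -/
abbrev fibration :
    letI := M.baseTensor.monoidalCategory
    letI := M.baseTensor.symmetricCategory
    letI := M.totalTensor.monoidalCategory
    letI := M.totalTensor.symmetricCategory
    SymmetricMonoidalFibration X.proj :=
  letI := M.baseTensor.monoidalCategory
  letI := M.baseTensor.symmetricCategory
  letI := M.totalTensor.monoidalCategory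
  letI := M.totalTensor.symmetricCategory
  { isFibered := X.isFibered
    braided := braidedOfIsHomLift X.proj (Hom.comm_obj M.one ⟨⟩).symm
      (fun x y => (Hom.comm_obj M.mul (x, y)).symm)
      (fun {x y x' y'} f g => Hom.map_over M.mul _ ((f, g) : (x, x') ⟶ (y, y'))
        ((prod_isHomLift_iff _ _).2 ⟨.map f, .map g⟩))
      (fun x y z => Hom₂.lies_over M.associator.hom ((x, y), z))
      (fun x => Hom₂.lies_over M.leftUnitor.hom x)
      (fun x => Hom₂.lies_over M.rightUnitor.hom x)
      (fun x y => Hom₂.lies_over M.braiding.hom (x, y))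
    ε_strict := ⟨(Hom.comm_obj M.one ⟨⟩).symm, rfl⟩
    μ_strict := fun x y => ⟨(Hom.comm_obj M.mul (x, y)).symm, rfl⟩
    tensor_cartesian := fun {x y x' y'} f f' hf hf' =>
      Hom.map_cartesian M.mul ((f, f') : (x, x') ⟶ (y, y'))
        (prod_isStronglyCartesian hf hf') }

/-- The lax symmetric monoidal section underlying a symmetric pseudomonoid. -/
abbrev laxSection :
    letI := M.baseTensor.monoidalCategory
    letI := M.baseTensor.symmetricCategory
    letI := M.totalTensor.monoidalCategory
    letI := M.totalTensor.symmetricCategory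
    LaxMonoidalSection X.proj X.sec :=
  letI := M.baseTensor.monoidalCategory
  letI := M.baseTensor.symmetricCategory
  letI := M.totalTensor.monoidalCategory
  letI := M.totalTensor.symmetricCategory
  { section_eq := X.sec_proj
    laxBraided :=
      { toLaxMonoidal := .mk ((Hom.comparison M.one).app ⟨⟩)
          (fun a b => (Hom.comparison M.mul).app (a, b))
          (fun {a b} f c => by
            -- Naturality of the laxator in one variable is naturality of the comparison at a pair
            -- whose other entry is an identity.
            rw [← MonoidalCategory.tensorHom_id, ← X.sec.map_id]
            exact (Hom.comparison M.mul).naturality ((f, 𝟙 c) : (a, c) ⟶ (b, c)))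
          (fun {a b} c f => by
            rw [← MonoidalCategory.id_tensorHom, ← X.sec.map_id]
            exact (Hom.comparison M.mul).naturality ((𝟙 c, f) : (c, a) ⟶ (c, b)))
          (fun a b c => by
            -- Compatibility of the associator with the comparisons is lax associativity, up to
            -- rebracketing.
            have h := Hom₂.comparison M.associator.hom ((a, b), c)
            rw [comparison_mulAt_mulAt_left, comparison_mulAt_mulAt_right] at h
            exact (Category.assoc _ _ _).symm.trans h)
          (fun a => by
            -- The target `𝟙 X` of the unitor has identity comparison, which `comp_id` removes.
            have h := Hom₂.comparison M.leftUnitor.hom a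
            rw [comparison_mulAt_one_left] at h
            exact ((Category.assoc _ _ _).symm.trans (h.trans (Category.comp_id _))).symm)
          (fun a => by
            have h := Hom₂.comparison M.rightUnitor.hom a
            rw [comparison_mulAt_one_right] at h
            exact ((Category.assoc _ _ _).symm.trans (h.trans (Category.comp_id _))).symm)
        braided := fun a b => by
          have h := Hom₂.comparison M.braiding.hom (a, b)
          rw [comparison_mulAt_fst_snd, comparison_mulAt_snd_fst] at h
          exact h }
    ε_over := Hom.comparison_over M.one ⟨⟩
    μ_over := fun a b => Hom.comparison_over M.mul (a, b) }

/-- The symmetric monoidal fibration with lax monoidal section given by a symmetric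
pseudomonoid. -/
abbrev toFibrationWithSection : SymmetricMonoidalFibrationWithSection X.proj X.sec :=
  letI := M.baseTensor.monoidalCategory
  letI := M.baseTensor.symmetricCategory
  letI := M.totalTensor.monoidalCategory
  letI := M.totalTensor.symmetricCategory
  { fibration := M.fibration
    laxSection := M.laxSection }

theorem corresponds_toFibrationWithSection : Corresponds M M.toFibrationWithSection :=
  letI := M.baseTensor.monoidalCategory
  letI := M.baseTensor.symmetricCategory
  letI := M.totalTensor.monoidalCategory
  letI := M.totalTensor.symmetricCategory
  letI := M.laxSection.laxBraided
  { tensor_base := rfl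
    tensor_total := rfl
    unit_base := rfl
    unit_total := rfl
    associator_base := fun _ _ _ => HEq.rfl
    associator_total := fun _ _ _ => HEq.rfl
    leftUnitor_base := fun _ => HEq.rfl
    leftUnitor_total := fun _ => HEq.rfl
    rightUnitor_base := fun _ => HEq.rfl
    rightUnitor_total := fun _ => HEq.rfl
    braiding_base := fun _ _ => HEq.rfl
    braiding_total := fun _ _ => HEq.rfl
    lax_tensor := fun _ _ => HEq.rfl
    lax_unit := HEq.rfl }

end SymmetricPseudomonoid

end Tangencies

/-! ### Invertible 2-cells -/

namespace Tangency

/-- A 2-cell of tangencies with invertible components is invertible. -/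
noncomputable def isoOfIsIsoApp {X Y : Tangency.{v, u}} {F G : X ⟶ Y} (η : Hom₂ F G)
    (hb : ∀ b, IsIso (η.base.app b)) (ht : ∀ e, IsIso (η.total.app e)) : F ≅ G where
  hom := η
  inv :=
    haveI := NatIso.isIso_of_isIso_app η.base
    haveI := NatIso.isIso_of_isIso_app η.total
    { base := inv η.base
      total := inv η.total
      -- Both conditions on a 2-cell pass to inverses: a lift that is invertible over an invertible
      -- arrow has its inverse over the inverse, and the comparison equation can be solved for the
      -- inverse components.
      lies_over := fun e => by
        have := η.lies_over e
        rw [NatIso.isIso_inv_app, NatIso.isIso_inv_app]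
        infer_instance
      comparison := fun b => by
        rw [NatIso.isIso_inv_app, NatIso.isIso_inv_app, CategoryTheory.Functor.map_inv,
          IsIso.comp_inv_eq, Category.assoc, η.comparison, IsIso.inv_hom_id_assoc] }
  hom_inv_id := by
    have := NatIso.isIso_of_isIso_app η.base
    have := NatIso.isIso_of_isIso_app η.total
    exact Hom₂.ext' (fun b => congrArg (fun κ => NatTrans.app κ b) (IsIso.hom_inv_id η.base))
      fun e => congrArg (fun κ => NatTrans.app κ e) (IsIso.hom_inv_id η.total)
  inv_hom_id := by
    have := NatIso.isIso_of_isIso_app η.base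
    have := NatIso.isIso_of_isIso_app η.total
    exact Hom₂.ext' (fun b => congrArg (fun κ => NatTrans.app κ b) (IsIso.inv_hom_id η.base))
      fun e => congrArg (fun κ => NatTrans.app κ e) (IsIso.inv_hom_id η.total)

end Tangency

/-! ### Pseudomonoid from a symmetric monoidal fibration with lax section -/

namespace Tangencies

open CartesianTwoCategory
open Tangency hiding prod fst snd lift lift₂ terminal toTerminal

namespace SymmetricMonoidalFibration

variable {X : Tangency.{v, u}} [MonoidalCategory X.Total] [SymmetricCategory X.Total]
  [MonoidalCategory X.Base] [SymmetricCategory X.Base]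
  (P : SymmetricMonoidalFibration X.proj) (L : LaxMonoidalSection X.proj X.sec)

/-- The multiplication of the pseudomonoid given by a symmetric monoidal fibration with a lax
monoidal section. -/
abbrev mul : prod X X ⟶ X :=
  letI := L.laxBraided
  Hom.mk (X := X.prod X) (Y := X) (MonoidalCategory.tensor X.Base)
    (MonoidalCategory.tensor X.Total)
    (CategoryTheory.Functor.ext (fun p => P.obj_tensor p.1 p.2)
      fun _ _ g => P.map_tensor g.1 g.2)
    -- The components of a cartesian arrow of the product fibration are cartesian.
    (fun g h => P.tensor_cartesian g.1 g.2 (fst_isStronglyCartesian h)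
      (snd_isStronglyCartesian h))
    { app := fun p => Functor.LaxMonoidal.μ X.sec p.1 p.2
      naturality := fun _ _ g => Functor.LaxMonoidal.μ_natural X.sec g.1 g.2 }
    (fun p => L.μ_over p.1 p.2)

/-- The unit of the pseudomonoid given by a symmetric monoidal fibration with a lax monoidal
section. -/
abbrev one : (terminal : Tangency.{v, u}) ⟶ X :=
  letI := L.laxBraided
  Hom.mk (X := Tangency.terminal) (Y := X)
    ((CategoryTheory.Functor.const _).obj (MonoidalCategoryStruct.tensorUnit X.Base))
    ((CategoryTheory.Functor.const _).obj (MonoidalCategoryStruct.tensorUnit X.Total))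
    (CategoryTheory.Functor.ext (fun _ => P.obj_unit) fun _ _ _ => by simp)
    -- A constant functor sends every arrow to an identity, and identities are cartesian.
    (fun _ _ => inferInstanceAs (X.proj.IsStronglyCartesian
      (X.proj.map (𝟙 (MonoidalCategoryStruct.tensorUnit X.Total)))
      (𝟙 (MonoidalCategoryStruct.tensorUnit X.Total))))
    { app := fun _ => Functor.LaxMonoidal.ε X.sec
      naturality := fun _ _ _ => by simp }
    (fun _ => L.ε_over)

/-- The associator as a 2-cell of tangencies. -/
abbrev associatorHom :
    Hom₂ (mulAt (P.mul L) (mulAt (P.mul L) (fst ≫ fst) (fst ≫ snd)) snd)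
      (mulAt (P.mul L) (fst ≫ fst) (mulAt (P.mul L) (fst ≫ snd) snd)) where
  base :=
    { app := fun p => (MonoidalCategoryStruct.associator p.1.1 p.1.2 p.2).hom
      naturality := fun _ _ g => MonoidalCategory.associator_naturality g.1.1 g.1.2 g.2 }
  total :=
    { app := fun p => (MonoidalCategoryStruct.associator p.1.1 p.1.2 p.2).hom
      naturality := fun _ _ g => MonoidalCategory.associator_naturality g.1.1 g.1.2 g.2 }
  lies_over p := P.associator_isHomLift p.1.1 p.1.2 p.2
  comparison := fun ((a, b), c) => by
    let := L.laxBraided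
    rw [comparison_mulAt_mulAt_left, comparison_mulAt_mulAt_right]
    have h := Functor.LaxMonoidal.associativity X.sec a b c
    rw [← MonoidalCategory.tensorHom_id, ← MonoidalCategory.id_tensorHom] at h
    exact (Category.assoc _ _ _).trans h

/-- The left unitor as a 2-cell of tangencies. -/
abbrev leftUnitorHom : Hom₂ (mulAt (P.mul L) (oneAt (P.one L) X) (𝟙 X)) (𝟙 X) where
  base :=
    { app := fun a => (MonoidalCategoryStruct.leftUnitor a).hom
      -- The functor `mulAt` produces a tensor product with an identity, whereas naturality of the
      -- unitor is stated with whiskering.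
      naturality := fun _ _ g => (congrArg (· ≫ _) (MonoidalCategory.id_tensorHom _ g)).trans
        (MonoidalCategory.leftUnitor_naturality g) }
  total :=
    { app := fun a => (MonoidalCategoryStruct.leftUnitor a).hom
      naturality := fun _ _ g => (congrArg (· ≫ _) (MonoidalCategory.id_tensorHom _ g)).trans
        (MonoidalCategory.leftUnitor_naturality g) }
  lies_over p := P.leftUnitor_isHomLift p
  comparison a := by
    let := L.laxBraided
    rw [comparison_mulAt_one_left]
    have h := Functor.LaxMonoidal.left_unitality X.sec a
    rw [← MonoidalCategory.tensorHom_id] at h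
    exact (Category.assoc _ _ _).trans (h.symm.trans (Category.comp_id _).symm)

/-- The right unitor as a 2-cell of tangencies. -/
abbrev rightUnitorHom : Hom₂ (mulAt (P.mul L) (𝟙 X) (oneAt (P.one L) X)) (𝟙 X) where
  base :=
    { app := fun a => (MonoidalCategoryStruct.rightUnitor a).hom
      naturality := fun _ _ g => (congrArg (· ≫ _) (MonoidalCategory.tensorHom_id g _)).trans
        (MonoidalCategory.rightUnitor_naturality g) }
  total :=
    { app := fun a => (MonoidalCategoryStruct.rightUnitor a).hom
      naturality := fun _ _ g => (congrArg (· ≫ _) (MonoidalCategory.tensorHom_id g _)).trans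
        (MonoidalCategory.rightUnitor_naturality g) }
  lies_over p := P.rightUnitor_isHomLift p
  comparison a := by
    let := L.laxBraided
    rw [comparison_mulAt_one_right]
    have h := Functor.LaxMonoidal.right_unitality X.sec a
    rw [← MonoidalCategory.id_tensorHom] at h
    exact (Category.assoc _ _ _).trans (h.symm.trans (Category.comp_id _).symm)

/-- The symmetry as a 2-cell of tangencies. -/
abbrev braidingHom : Hom₂ (mulAt (P.mul L) fst snd) (mulAt (P.mul L) snd fst) where
  base :=
    { app := fun p => (BraidedCategory.braiding p.1 p.2).hom
      naturality := fun _ _ g => BraidedCategory.braiding_naturality g.1 g.2 }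
  total :=
    { app := fun p => (BraidedCategory.braiding p.1 p.2).hom
      naturality := fun _ _ g => BraidedCategory.braiding_naturality g.1 g.2 }
  lies_over p := P.braiding_isHomLift p.1 p.2
  comparison := fun (a, b) => by
    let := L.laxBraided
    rw [comparison_mulAt_fst_snd, comparison_mulAt_snd_fst]
    exact Functor.LaxBraided.braided a b

/-- The data of the pseudomonoid given by a symmetric monoidal fibration with a lax monoidal
section. -/
noncomputable abbrev toSymmetricPseudomonoidData : SymmetricPseudomonoidData X where
  mul := P.mul L
  one := P.one L
  associator := isoOfIsIsoApp (P.associatorHom L)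
    (fun p => inferInstanceAs (IsIso (MonoidalCategoryStruct.associator p.1.1 p.1.2 p.2).hom))
    (fun p => inferInstanceAs (IsIso (MonoidalCategoryStruct.associator p.1.1 p.1.2 p.2).hom))
  leftUnitor := isoOfIsIsoApp (P.leftUnitorHom L)
    (fun a => inferInstanceAs (IsIso (MonoidalCategoryStruct.leftUnitor a).hom))
    (fun a => inferInstanceAs (IsIso (MonoidalCategoryStruct.leftUnitor a).hom))
  rightUnitor := isoOfIsIsoApp (P.rightUnitorHom L)
    (fun a => inferInstanceAs (IsIso (MonoidalCategoryStruct.rightUnitor a).hom))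
    (fun a => inferInstanceAs (IsIso (MonoidalCategoryStruct.rightUnitor a).hom))
  braiding := isoOfIsIsoApp (P.braidingHom L)
    (fun p => inferInstanceAs (IsIso (BraidedCategory.braiding p.1 p.2).hom))
    (fun p => inferInstanceAs (IsIso (BraidedCategory.braiding p.1 p.2).hom))

/-- This and the next two restate the axioms with `tensorHom` and identities instead of whiskerings,
which is the shape that `mulMap` has on components. -/
theorem tensorHom_pentagon {C : Type*} [Category* C] [MonoidalCategory C] (a b c d : C) :
    MonoidalCategoryStruct.tensorHom (MonoidalCategoryStruct.associator a b c).hom (𝟙 d) ≫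
        (MonoidalCategoryStruct.associator a _ d).hom ≫
          MonoidalCategoryStruct.tensorHom (𝟙 a) (MonoidalCategoryStruct.associator b c d).hom =
      (MonoidalCategoryStruct.associator _ c d).hom ≫
        (MonoidalCategoryStruct.associator a b _).hom := by
  simp

theorem tensorHom_triangle {C : Type*} [Category* C] [MonoidalCategory C] (a b : C) :
    (MonoidalCategoryStruct.associator a _ b).hom ≫
        MonoidalCategoryStruct.tensorHom (𝟙 a) (MonoidalCategoryStruct.leftUnitor b).hom =
      MonoidalCategoryStruct.tensorHom (MonoidalCategoryStruct.rightUnitor a).hom (𝟙 b) := by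
  simp

theorem tensorHom_hexagon {C : Type*} [Category* C] [MonoidalCategory C] [BraidedCategory C]
    (a b c : C) :
    (MonoidalCategoryStruct.associator a b c).hom ≫ (BraidedCategory.braiding a _).hom ≫
        (MonoidalCategoryStruct.associator b c a).hom =
      MonoidalCategoryStruct.tensorHom (BraidedCategory.braiding a b).hom (𝟙 c) ≫
        (MonoidalCategoryStruct.associator b a c).hom ≫
          MonoidalCategoryStruct.tensorHom (𝟙 b) (BraidedCategory.braiding a c).hom := by
  rw [MonoidalCategory.tensorHom_id, MonoidalCategory.id_tensorHom]
  exact BraidedCategory.hexagon_forward a b c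

/-- The symmetric pseudomonoid given by a symmetric monoidal fibration with a lax monoidal
section. -/
noncomputable abbrev toSymmetricPseudomonoid : SymmetricPseudomonoid X where
  toSymmetricPseudomonoidData := P.toSymmetricPseudomonoidData L
  pentagon a b c d := by
    -- Evaluated at `z`, generalised elements become objects, and each component of the axiom is the
    -- corresponding axiom of an ordinary monoidal category.
    apply Hom₂.ext'
    · intro z
      simp only [comp_base_app, mulMap_base_app, assocAt_base_app]
      exact tensorHom_pentagon _ _ _ _
    · intro z
      simp only [comp_total_app, mulMap_total_app, assocAt_total_app]
      exact tensorHom_pentagon _ _ _ _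
  triangle a b := by
    apply Hom₂.ext'
    · intro z
      simp only [comp_base_app, mulMap_base_app, assocAt_base_app, leftUnitorAt_base_app,
        rightUnitorAt_base_app]
      exact tensorHom_triangle _ _
    · intro z
      simp only [comp_total_app, mulMap_total_app, assocAt_total_app, leftUnitorAt_total_app,
        rightUnitorAt_total_app]
      exact tensorHom_triangle _ _
  hexagon a b c := by
    apply Hom₂.ext'
    · intro z
      simp only [comp_base_app, mulMap_base_app, assocAt_base_app, braidingAt_base_app]
      exact tensorHom_hexagon _ _ _
    · intro z
      simp only [comp_total_app, mulMap_total_app, assocAt_total_app, braidingAt_total_app]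
      exact tensorHom_hexagon _ _ _
  symmetry a b := by
    apply Hom₂.ext'
    · intro z
      simp only [comp_base_app, braidingAt_base_app]
      exact SymmetricCategory.symmetry _ _
    · intro z
      simp only [comp_total_app, braidingAt_total_app]
      exact SymmetricCategory.symmetry _ _

end SymmetricMonoidalFibration

theorem SymmetricMonoidalFibrationWithSection.exists_corresponds {X : Tangency.{v, u}}
    (N : SymmetricMonoidalFibrationWithSection X.proj X.sec) :
    ∃ M : SymmetricPseudomonoid X, Corresponds M N :=
  letI := N.monoidalTotal
  letI := N.symmetricTotal
  letI := N.monoidalBase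
  letI := N.symmetricBase
  letI := N.laxSection.laxBraided
  ⟨N.fibration.toSymmetricPseudomonoid N.laxSection,
  { tensor_base := rfl
    tensor_total := rfl
    unit_base := rfl
    unit_total := rfl
    associator_base := fun _ _ _ => HEq.rfl
    associator_total := fun _ _ _ => HEq.rfl
    leftUnitor_base := fun _ => HEq.rfl
    leftUnitor_total := fun _ => HEq.rfl
    rightUnitor_base := fun _ => HEq.rfl
    rightUnitor_total := fun _ => HEq.rfl
    braiding_base := fun _ _ => HEq.rfl
    braiding_total := fun _ _ => HEq.rfl
    lax_tensor := fun _ _ => HEq.rfl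
    lax_unit := HEq.rfl }⟩

end Tangencies

/-! ### Uniqueness of corresponding structures in both directions -/

namespace Tangencies

open CartesianTwoCategory
open Tangency hiding prod fst snd lift lift₂ terminal toTerminal

/-- The only arrow of the point is its identity, so a functor out of it is determined by one object.
-/
theorem functor_point_ext {C : Type*} [Category* C] {F G : Point.{u} ⥤ C}
    (h : F.obj ⟨⟩ = G.obj ⟨⟩) : F = G :=
  CategoryTheory.Functor.ext (fun _ => h) fun p _ _ => by
    have hF := F.map_id p
    have hG := G.map_id p
    refine hF.trans ?_
    change _ = _ ≫ G.map (𝟙 p) ≫ _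
    rw [hG]
    simp

theorem SameData.unique {X : Tangency.{v, u}} {M M' : SymmetricPseudomonoid X}
    [MonoidalCategory X.Total] [SymmetricCategory X.Total]
    [MonoidalCategory X.Base] [SymmetricCategory X.Base] [X.sec.LaxBraided]
    (h : SameData M) (h' : SameData M') : M = M' := by
  have hmul : M.mul = M'.mul :=
    Hom.ext' (h.tensor_base.trans h'.tensor_base.symm) (h.tensor_total.trans h'.tensor_total.symm)
      fun p => (h.lax_tensor p.1 p.2).trans (h'.lax_tensor p.1 p.2).symm
  have hone : M.one = M'.one :=
    Hom.ext' (functor_point_ext (h.unit_base.trans h'.unit_base.symm))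
      (functor_point_ext (h.unit_total.trans h'.unit_total.symm))
      fun _ => h.lax_unit.trans h'.lax_unit.symm
  have hαb := fun a b c => (h.associator_base a b c).trans (h'.associator_base a b c).symm
  have hαt := fun a b c => (h.associator_total a b c).trans (h'.associator_total a b c).symm
  have hlb := fun a => (h.leftUnitor_base a).trans (h'.leftUnitor_base a).symm
  have hlt := fun a => (h.leftUnitor_total a).trans (h'.leftUnitor_total a).symm
  have hrb := fun a => (h.rightUnitor_base a).trans (h'.rightUnitor_base a).symm
  have hrt := fun a => (h.rightUnitor_total a).trans (h'.rightUnitor_total a).symm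
  have hβb := fun a b => (h.braiding_base a b).trans (h'.braiding_base a b).symm
  have hβt := fun a b => (h.braiding_total a b).trans (h'.braiding_total a b).symm
  clear h h'
  obtain ⟨⟨m, i, α, l, r, β⟩, _, _, _, _⟩ := M
  obtain ⟨⟨m', i', α', l', r', β'⟩, _, _, _, _⟩ := M'
  -- Multiplication and unit are identified first: the types of the structural 2-cells depend on
  -- them, and only then do the heterogeneous equalities become equalities.
  obtain rfl : m = m' := hmul
  obtain rfl : i = i' := hone
  obtain rfl : α = α' := Iso.ext (Hom₂.ext' (fun p => eq_of_heq (hαb p.1.1 p.1.2 p.2))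
    fun p => eq_of_heq (hαt p.1.1 p.1.2 p.2))
  obtain rfl : l = l' := Iso.ext (Hom₂.ext' (fun a => eq_of_heq (hlb a))
    fun a => eq_of_heq (hlt a))
  obtain rfl : r = r' := Iso.ext (Hom₂.ext' (fun a => eq_of_heq (hrb a))
    fun a => eq_of_heq (hrt a))
  obtain rfl : β = β' := Iso.ext (Hom₂.ext' (fun p => eq_of_heq (hβb p.1 p.2))
    fun p => eq_of_heq (hβt p.1 p.2))
  rfl

section Uniqueness

variable {C : Type u} [Category.{v} C]

/-- The tensor functor carries the tensor of objects and of arrows, and the whiskerings are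
redundant, being tensor products with identities. The structure isomorphisms are compared
heterogeneously because their endpoints depend on the structure. -/
theorem monoidalCategory_ext (m m' : MonoidalCategory C)
    (ht : @MonoidalCategory.tensor C _ m = @MonoidalCategory.tensor C _ m')
    (hu : m.tensorUnit = m'.tensorUnit)
    (hα : ∀ a b c, HEq (m.associator a b c).hom (m'.associator a b c).hom)
    (hl : ∀ a, HEq (m.leftUnitor a).hom (m'.leftUnitor a).hom)
    (hr : ∀ a, HEq (m.rightUnitor a).hom (m'.rightUnitor a).hom) : m = m' := by
  have hO : m.tensorObj = m'.tensorObj :=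
    funext fun a => funext fun b => CategoryTheory.Functor.congr_obj ht (a, b)
  have hH {a b c d : C} (f : a ⟶ b) (g : c ⟶ d) : HEq (m.tensorHom f g) (m'.tensorHom f g) :=
    Functor.hcongr_hom ht ((f, g) : (a, c) ⟶ (b, d))
  have hL (a : C) {b c : C} (f : b ⟶ c) : HEq (m.whiskerLeft a f) (m'.whiskerLeft a f) := by
    have := hH (𝟙 a) f
    rwa [@MonoidalCategory.id_tensorHom _ _ m, @MonoidalCategory.id_tensorHom _ _ m'] at this
  have hR {a b : C} (f : a ⟶ b) (c : C) : HEq (m.whiskerRight f c) (m'.whiskerRight f c) := by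
    have := hH f (𝟙 c)
    rwa [@MonoidalCategory.tensorHom_id _ _ m, @MonoidalCategory.tensorHom_id _ _ m'] at this
  clear ht
  obtain @⟨@⟨O, L, R, H, U, α, l, r⟩, _, _, _, _, _, _, _, _, _, _⟩ := m
  obtain @⟨@⟨O', L', R', H', U', α', l', r'⟩, _, _, _, _, _, _, _, _, _, _⟩ := m'
  obtain rfl : O = O' := hO
  obtain rfl : U = U' := hu
  obtain rfl : @L = @L' := by
    funext a b c f
    exact eq_of_heq (hL a f)
  obtain rfl : @R = @R' := by
    funext a b f c
    exact eq_of_heq (hR f c)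
  obtain rfl : @H = @H' := by
    funext a b c d f g
    exact eq_of_heq (hH f g)
  obtain rfl : α = α' := funext fun a => funext fun b => funext fun c =>
    Iso.ext (eq_of_heq (hα a b c))
  obtain rfl : l = l' := funext fun a => Iso.ext (eq_of_heq (hl a))
  obtain rfl : r = r' := funext fun a => Iso.ext (eq_of_heq (hr a))
  rfl

theorem symmetricCategory_ext [MonoidalCategory C] (s s' : SymmetricCategory C)
    (h : ∀ a b, HEq (s.braiding a b).hom (s'.braiding a b).hom) : s = s' := by
  obtain @⟨@⟨β, _, _, _, _⟩, _⟩ := s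
  obtain @⟨@⟨β', _, _, _, _⟩, _⟩ := s'
  obtain rfl : β = β' := funext fun a => funext fun b => Iso.ext (eq_of_heq (h a b))
  rfl

theorem LaxMonoidalSection.ext {E B : Type u} [Category.{v} E] [Category.{v} B]
    [MonoidalCategory E] [SymmetricCategory E] [MonoidalCategory B] [SymmetricCategory B]
    {π : E ⥤ B} {T : B ⥤ E} (L L' : LaxMonoidalSection π T)
    (hε : @Functor.LaxMonoidal.ε _ _ _ _ _ _ T L.laxBraided.toLaxMonoidal =
      @Functor.LaxMonoidal.ε _ _ _ _ _ _ T L'.laxBraided.toLaxMonoidal)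
    (hμ : ∀ a b, @Functor.LaxMonoidal.μ _ _ _ _ _ _ T L.laxBraided.toLaxMonoidal a b =
      @Functor.LaxMonoidal.μ _ _ _ _ _ _ T L'.laxBraided.toLaxMonoidal a b) : L = L' := by
  obtain ⟨_, @⟨⟨e, m, _, _, _, _, _⟩, _⟩, _, _⟩ := L
  obtain ⟨_, @⟨⟨e', m', _, _, _, _, _⟩, _⟩, _, _⟩ := L'
  obtain rfl : e = e' := hε
  obtain rfl : m = m' := funext fun a => funext fun b => hμ a b
  rfl

end Uniqueness

theorem Corresponds.pseudomonoid_unique {X : Tangency.{v, u}} {M M' : SymmetricPseudomonoid X}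
    {N : SymmetricMonoidalFibrationWithSection X.proj X.sec}
    (h : Corresponds M N) (h' : Corresponds M' N) : M = M' :=
  letI := N.monoidalTotal
  letI := N.symmetricTotal
  letI := N.monoidalBase
  letI := N.symmetricBase
  letI := N.laxSection.laxBraided
  SameData.unique h h'

theorem Corresponds.fibration_unique {X : Tangency.{v, u}} {M : SymmetricPseudomonoid X}
    {N N' : SymmetricMonoidalFibrationWithSection X.proj X.sec}
    (h : Corresponds M N) (h' : Corresponds M N') : N = N' := by
  obtain @⟨mt, st, mb, sb, P, L⟩ := N
  obtain @⟨mt', st', mb', sb', P', L'⟩ := N'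
  obtain ⟨tb, tt, ub, ut, αb, αt, lb, lt,
    rb, rt, βb, βt, μT, εT⟩ := h
  obtain ⟨tb', tt', ub', ut', αb', αt', lb', lt',
    rb', rt', βb', βt', μT', εT'⟩ := h'
  -- The shared pseudomonoid mediates each comparison. The monoidal structures come first, since the
  -- symmetries, the fibration and the section are typed over them.
  obtain rfl : mt = mt' := monoidalCategory_ext mt mt'
    (tt.symm.trans tt') (ut.symm.trans ut')
    (fun a b c => (αt a b c).symm.trans (αt' a b c))
    (fun a => (lt a).symm.trans (lt' a))
    (fun a => (rt a).symm.trans (rt' a))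
  obtain rfl : mb = mb' := monoidalCategory_ext mb mb'
    (tb.symm.trans tb') (ub.symm.trans ub')
    (fun a b c => (αb a b c).symm.trans (αb' a b c))
    (fun a => (lb a).symm.trans (lb' a))
    (fun a => (rb a).symm.trans (rb' a))
  obtain rfl : st = st' := symmetricCategory_ext st st'
    fun a b => (βt a b).symm.trans (βt' a b)
  obtain rfl : sb = sb' := symmetricCategory_ext sb sb'
    fun a b => (βb a b).symm.trans (βb' a b)
  obtain rfl : P = P' := SymmetricMonoidalFibration.subsingleton.elim P P'
  obtain rfl : L = L' := LaxMonoidalSection.ext L L'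
    (eq_of_heq (εT.symm.trans εT'))
    fun a b => eq_of_heq ((μT a b).symm.trans (μT' a b))
  rfl

end Tangencies

/-! ### The bijection -/

theorem mainTheorem11 (X : Tangency.{v, u}) :
    ∃ e : Tangencies.SymmetricPseudomonoid X ≃
        Tangencies.SymmetricMonoidalFibrationWithSection X.proj X.sec,
      ∀ M : Tangencies.SymmetricPseudomonoid X, Tangencies.Corresponds M (e M) := by
  -- Pseudomonoids with the same image correspond to one and the same structure, hence coincide. A
  -- given `N` is hit because a pseudomonoid corresponding to it also corresponds to its own image,
  -- which must then be `N`.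
  refine ⟨Equiv.ofBijective (fun M => M.toFibrationWithSection) ⟨fun M M' h => ?_, fun N => ?_⟩,
    fun M => M.corresponds_toFibrationWithSection⟩
  · have h₁ := M.corresponds_toFibrationWithSection
    have h₂ := M'.corresponds_toFibrationWithSection
    dsimp only at h
    rw [h] at h₁
    exact h₁.pseudomonoid_unique h₂
  · obtain ⟨M, hM⟩ := N.exists_corresponds
    exact ⟨M, M.corresponds_toFibrationWithSection.fibration_unique hM⟩
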